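/- **Setting.** Let $\mathcal S,\mathcal A$ be standard Borel spaces (states, actions), $\rho$ an initial distribution on $\mathcal S$, $\mathcal P(\cdot\mid s,a)$ a transition kernel and $\gamma\in(0,1)$. Let $\mathcal T$ be a probability distribution over tasks $\mathcal M=(\mathcal S,\mathcal A,\mathcal P,\mathcal R_{\mathcal M},\gamma)$, labelled by a standard Borel space, which share everything except the reward $\mathcal R_{\mathcal M}(s,a)\in\mathbb R$; the reward is jointly measurable in $(\mathcal M,s,a)$, and $|\mathcal R_{\mathcal M}(s,a)|\le B(\mathcal M)$ with $\mathbb E_{\mathcal M\sim\mathcal T}[B(\mathcal M)]<\infty$. Let $\mathcal L=\bigcup_{t\ge1}\mathcal L_t$ with $\mathcal L_t=(\mathcal S\times\mathcal A\times\mathbb R)^{t-1}\times\mathcal S$ be the set of partial trajectories, and let $\Pi_3$ be the set of (measurable) policies $\pi:\mathcal L\to\Delta(\mathcal A)$. Each task $\mathcal M$ induces an MDP $\tilde{\mathcal M}$ with state space $\mathcal L$: in state $l=(s_1,a_1,r_1,\dots,s_t)$, the action $a_t$ gives the reward $r_t=\mathcal R_{\mathcal M}(s_t,a_t)$ and leads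 to the state $(s_1,a_1,r_1,\dots,s_t,a_t,r_t,s_{t+1})$ with $s_{t+1}\sim\mathcal P(\cdot\mid s_t,a_t)$; its initial state is $l=(s_1)$ with $s_1\sim\rho$. For $\pi\in\Pi_3$ let $J_{\mathcal M}(\pi)$ be the expected discounted return $\mathbb E\big[\sum_{k\ge0}\gamma^k\,\mathcal R_{\mathcal M}(s_{k+1},a_{k+1})\big]$ of $\pi$ in $\tilde{\mathcal M}$, let $Q^*_{\mathcal M}(l,a)$ be the maximum over $\pi\in\Pi_3$ of the expected discounted return in $\tilde{\mathcal M}$ when starting in $l$ with the action $a$ and following $\pi$ afterwards, and let $J^*_{\mathcal T}=\mathbb E_{\mathcal M\sim\mathcal T}[\max_{\pi\in\Pi_3}J_{\mathcal M}(\pi)]$. Assume that the maxima over policies exist: every task $\mathcal M$ has an optimal policy $\pi^*_{\mathcal M}\in\Pi_3$, i.e. one that maximizes the expected discounted return in $\tilde{\mathcal M}$ from every $l\in\mathcal L$, and $\pi^*_{\mathcal M}(\cdot\mid l)$ depends measurably on $(\mathcal M,l)$. For $\pi\in\Pi_3$ let $d_{\tilde{\mathcal M},\pi}=(1-\gamma)\sum_{k\ge0}\gamma^k\,\mathbb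 P(l_k\in\cdot)$ be the normalized discounted occupancy on $\mathcal L$, where $l_0,l_1,\dots$ are the states visited by $\pi$ in $\tilde{\mathcal M}$. Let $p(l)=\mathbb E_{\mathcal M\sim\mathcal T}[d_{\tilde{\mathcal M},\pi}(l)]$, a probability distribution on $\mathcal L$, and let the task posterior $p(\mathcal M\mid l)$ be the conditional distribution of $\mathcal M$ given $l$ under the joint law $\mathcal T(d\mathcal M)\,d_{\tilde{\mathcal M},\pi}(dl)$. **Theorem.** For every $\pi\in\Pi_3$, all the expectations below are well defined and finite (those over the posterior for $p$-almost every $l$), and $$ \begin{aligned} J^*_{\mathcal T}-\mathbb E_{\mathcal M\sim\mathcal T}[J_{\mathcal M}(\pi)] &=\frac1{1-\gamma}\int_{\mathcal L}p(dl)\left[\int p(d\mathcal M\mid l)\,\max_a Q^*_{\mathcal M}(l,a)-\int \pi(da\mid l)\,p(d\mathcal M\mid l)\,Q^*_{\mathcal M}(l,a)\right]\\ &\ge\frac1{1-\gamma}\int_{\mathcal L}p(dl)\left[\int p(d\mathcal M\mid l)\,\max_a Q^*_{\mathcal M}(l,a)-\sup_a\int p(d\mathcal M\mid l)\,Q^*_{\mathcal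 M}(l,a)\right]. \end{aligned} $$ -/

import Mathlib

open MeasureTheory ProbabilityTheory
open scoped ENNReal

noncomputable section

universe u v w

/-- A discounted Markov decision process with state space `X` and action space `A`. -/
structure MDP (X : Type u) (A : Type v) [MeasurableSpace X] [MeasurableSpace A] where
  trans : Kernel (X × A) X
  isMarkov : IsMarkovKernel trans
  reward : X → A → ℝ
  measurable_reward : Measurable (Function.uncurry reward)
  γ : ℝ
  γ_pos : 0 < γ
  γ_lt_one : γ < 1

attribute [instance] MDP.isMarkov

/-- Randomized policies `X → Δ(A)`. -/
abbrev Policy (X : Type u) (A : Type v) [MeasurableSpace X] [MeasurableSpace A] :=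
  {π : Kernel X A // IsMarkovKernel π}

namespace MDP

variable {X : Type u} {A : Type v} [MeasurableSpace X] [MeasurableSpace A]

/-- One step of the state-action chain: `x' ∼ trans (x, a)`, then `a' ∼ π x'`. -/
def step (M : MDP X A) (π : Kernel X A) : Kernel (X × A) (X × A) :=
  (Kernel.id ×ₖ π) ∘ₖ M.trans

instance (M : MDP X A) (π : Kernel X A) [IsMarkovKernel π] : IsMarkovKernel (M.step π) := by
  unfold step; infer_instance

/-- Law of the infinite state-action trajectory when `(x₀, a₀) ∼ μ` and the later actions are
drawn from `π`. -/
def pathLaw (M : MDP X A) (π : Kernel X A) [IsMarkovKernel π] (μ : Measure (X × A)) :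
    Measure (ℕ → X × A) :=
  Kernel.trajMeasure (X := fun _ => X × A) μ
    (fun n => (M.step π).comap (fun h => h ⟨n, Finset.mem_Iic.2 le_rfl⟩) (measurable_pi_apply _))

/-- The discounted return `∑ₜ γᵗ rₜ` of a trajectory. -/
def discountedReturn (M : MDP X A) (ω : ℕ → X × A) : ℝ :=
  ∑' t, M.γ ^ t * M.reward (ω t).1 (ω t).2

/-- Expected discounted return of `π` from the initial state distribution `ρ`. -/
def J (M : MDP X A) (ρ : Measure X) (π : Kernel X A) [IsMarkovKernel π] : ℝ :=
  ∫ ω, M.discountedReturn ω ∂(M.pathLaw π (ρ ⊗ₘ π))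

/-- State value function of `π`. -/
def V (M : MDP X A) (π : Kernel X A) [IsMarkovKernel π] (x : X) : ℝ :=
  M.J (Measure.dirac x) π

/-- State-action value function of `π`. -/
def Q (M : MDP X A) (π : Kernel X A) [IsMarkovKernel π] (x : X) (a : A) : ℝ :=
  ∫ ω, M.discountedReturn ω ∂(M.pathLaw π (Measure.dirac (x, a)))

/-- Optimal state-action value function. -/
def Qstar (M : MDP X A) (x : X) (a : A) : ℝ :=
  ⨆ π : Policy X A, haveI := π.2; M.Q π.1 x a

/-- Optimal return from the initial state distribution `ρ`. -/
def Jstar (M : MDP X A) (ρ : Measure X) : ℝ :=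
  ⨆ π : Policy X A, haveI := π.2; M.J ρ π.1

/-- `π` attains the maximal value simultaneously at every state. -/
def IsOptimal (M : MDP X A) (π : Kernel X A) [IsMarkovKernel π] : Prop :=
  ∀ π' : Policy X A, haveI := π'.2; ∀ x, M.V π'.1 x ≤ M.V π x

/-- Law of the state `xₜ` when `x₀ ∼ ρ` and all actions are drawn from `π`. -/
def stateLaw (M : MDP X A) (ρ : Measure X) (π : Kernel X A) [IsMarkovKernel π] (t : ℕ) :
    Measure X :=
  (M.pathLaw π (ρ ⊗ₘ π)).map (fun ω => (ω t).1)

/-- Normalized discounted state occupancy `(1 - γ) ∑ₜ γᵗ ℙ(xₜ ∈ ·)`. -/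
def occupancy (M : MDP X A) (ρ : Measure X) (π : Kernel X A) [IsMarkovKernel π] : Measure X :=
  Measure.sum fun t => ENNReal.ofReal ((1 - M.γ) * M.γ ^ t) • M.stateLaw ρ π t

instance (M : MDP X A) (π : Kernel X A) [IsMarkovKernel π] (μ : Measure (X × A))
    [IsProbabilityMeasure μ] : IsProbabilityMeasure (M.pathLaw π μ) := by
  unfold pathLaw; infer_instance

instance (M : MDP X A) (ρ : Measure X) [IsProbabilityMeasure ρ] (π : Kernel X A)
    [IsMarkovKernel π] (t : ℕ) : IsProbabilityMeasure (M.stateLaw ρ π t) :=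
  Measure.isProbabilityMeasure_map
    (measurable_fst.comp (measurable_pi_apply t)).aemeasurable

lemma tsum_occupancy_weights (M : MDP X A) :
    ∑' t, ENNReal.ofReal ((1 - M.γ) * M.γ ^ t) = 1 := by
  have h0 := M.γ_pos.le
  have h1 : 0 ≤ 1 - M.γ := by linarith [M.γ_lt_one]
  rw [← ENNReal.ofReal_tsum_of_nonneg (fun t => by positivity)
    ((summable_geometric_of_lt_one h0 M.γ_lt_one).mul_left _), tsum_mul_left,
    tsum_geometric_of_lt_one h0 M.γ_lt_one, mul_inv_cancel₀ (by linarith [M.γ_lt_one]),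
    ENNReal.ofReal_one]

instance (M : MDP X A) (ρ : Measure X) [IsProbabilityMeasure ρ] (π : Kernel X A)
    [IsMarkovKernel π] : IsProbabilityMeasure (M.occupancy ρ π) := by
  constructor
  simp only [occupancy, Measure.sum_apply _ MeasurableSet.univ, Measure.smul_apply,
    measure_univ, smul_eq_mul, mul_one]
  exact M.tsum_occupancy_weights

lemma pathLaw_map_zero (M : MDP X A) (π : Kernel X A) [IsMarkovKernel π] (μ : Measure (X × A))
    [IsProbabilityMeasure μ] : (M.pathLaw π μ).map (fun ω => ω 0) = μ := by
  have h : Measurable fun h : (i : Finset.Iic 0) → X × A => h ⟨0, by simp⟩ :=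
    measurable_pi_apply _
  have e : (fun ω : ℕ → X × A => ω 0) =
      (fun h : (i : Finset.Iic 0) → X × A => h ⟨0, by simp⟩) ∘ Preorder.frestrictLe 0 := rfl
  rw [e, ← Measure.map_map h (by fun_prop), pathLaw, Kernel.trajMeasure,
    Measure.map_comp _ _ (by fun_prop), Kernel.traj_map_frestrictLe, Kernel.partialTraj_self,
    Measure.id_comp, Measure.map_map h (by fun_prop)]
  exact Measure.map_id

lemma pathLaw_map_succ (M : MDP X A) (π : Kernel X A) [IsMarkovKernel π] (μ : Measure (X × A))
    [IsProbabilityMeasure μ] (t : ℕ) :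
    (M.pathLaw π μ).map (fun ω => ω (t + 1)) =
      ((M.pathLaw π μ).map (fun ω => ω t)).bind (M.step π) := by
  have key := Kernel.map_frestrictLe_trajMeasure_compProd_eq_map_trajMeasure
    (X := fun _ => X × A) (μ₀ := μ) (a := t)
    (κ := fun n => (M.step π).comap (fun h => h ⟨n, Finset.mem_Iic.2 le_rfl⟩)
      (measurable_pi_apply _))
  have key2 := congrArg Measure.snd key
  rw [Measure.snd_compProd] at key2
  change _ = ((M.pathLaw π μ).map _).map Prod.snd at key2
  rw [Measure.map_map measurable_snd (by fun_prop)] at key2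
  change _ = (M.pathLaw π μ).map (fun ω => ω (t + 1)) at key2
  rw [← key2]
  have e : (fun ω : ℕ → X × A => ω t) =
      (fun h : (i : Finset.Iic t) → X × A => h ⟨t, Finset.mem_Iic.2 le_rfl⟩) ∘
        Preorder.frestrictLe t := rfl
  rw [e, ← Measure.map_map (measurable_pi_apply _) (by fun_prop)]
  ext B hB
  rw [Measure.bind_apply hB (Kernel.aemeasurable _), Measure.bind_apply hB (Kernel.aemeasurable _),
    lintegral_map (Kernel.measurable_coe _ hB) (measurable_pi_apply _)]
  rfl

end MDP

/-- Partial trajectories `(s₀, a₀, r₀, …, sₜ)`: the disjoint union over `t` of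
`(S × A × ℝ)ᵗ × S`. -/
abbrev PartialTraj (S : Type u) (A : Type v) := Σ t : ℕ, (Fin t → S × A × ℝ) × S

namespace PartialTraj

variable {S : Type u} {A : Type v} [MeasurableSpace S] [MeasurableSpace A]

/-- The partial trajectory consisting of one state. -/
def start (s : S) : PartialTraj S A := ⟨0, Fin.elim0, s⟩

/-- The current (last) state. -/
def last (l : PartialTraj S A) : S := l.2.2

/-- Extend a partial trajectory by an action, a reward and the next state. -/
def extend (l : PartialTraj S A) (a : A) (r : ℝ) (s' : S) : PartialTraj S A :=
  ⟨l.1 + 1, Fin.snoc (α := fun _ => S × A × ℝ) l.2.1 (l.last, a, r), s'⟩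

lemma measurable_mk (t : ℕ) :
    Measurable (fun y : (Fin t → S × A × ℝ) × S => (⟨t, y⟩ : PartialTraj S A)) :=
  fun _ hB => MeasurableSpace.measurableSet_iInf.1 hB t

/-- A function of a partial trajectory and a parameter is measurable if it is so on trajectories
of each fixed length. -/
lemma measurable_of_mk {Y Z : Type*} [MeasurableSpace Y] [MeasurableSpace Z]
    {f : PartialTraj S A × Y → Z}
    (hf : ∀ t, Measurable fun x : ((Fin t → S × A × ℝ) × S) × Y => f (⟨t, x.1⟩, x.2)) :
    Measurable f := by
  have hinj : ∀ t, Function.Injective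
      (fun y : (Fin t → S × A × ℝ) × S => (⟨t, y⟩ : PartialTraj S A)) :=
    fun t y z h => eq_of_heq (Sigma.mk.inj h).2
  have hemb : ∀ t, MeasurableEmbedding
      (fun y : (Fin t → S × A × ℝ) × S => (⟨t, y⟩ : PartialTraj S A)) := fun t =>
    { injective := hinj t
      measurable := measurable_mk t
      measurableSet_image' := fun B hB => MeasurableSpace.measurableSet_iInf.2 fun t' => by
        change MeasurableSet ((fun y => (⟨t', y⟩ : PartialTraj S A)) ⁻¹'
          ((fun y => (⟨t, y⟩ : PartialTraj S A)) '' B))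
        by_cases h : t' = t
        · subst h
          rwa [Set.preimage_image_eq _ (hinj t')]
        · convert MeasurableSet.empty
          ext y
          simp only [Set.mem_preimage, Set.mem_image, Set.mem_empty_iff_false, iff_false]
          rintro ⟨z, _, hz⟩
          exact h (congrArg Sigma.fst hz).symm }
  intro B hB
  have : f ⁻¹' B = ⋃ t, Prod.map (Sigma.mk t) id ''
      ((fun x : ((Fin t → S × A × ℝ) × S) × Y => f (⟨t, x.1⟩, x.2)) ⁻¹' B) := by
    ext ⟨⟨t, y⟩, z⟩
    simp only [Set.mem_preimage, Set.mem_iUnion, Set.mem_image]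
    constructor
    · intro h
      exact ⟨t, (y, z), h, rfl⟩
    · rintro ⟨t', x, hx, he⟩
      rw [← he]
      exact hx
  rw [this]
  exact MeasurableSet.iUnion fun t =>
    ((hemb t).prodMap MeasurableEmbedding.id).measurableSet_image' (hf t hB)

lemma measurable_start : Measurable (start : S → PartialTraj S A) :=
  (measurable_mk 0).comp (measurable_const.prodMk measurable_id)

lemma measurable_last : Measurable (last : PartialTraj S A → S) :=
  (measurable_of_mk (Y := Unit) (f := fun x => last x.1)
    fun _ => measurable_snd.comp measurable_fst).comp (measurable_id.prodMk
      (measurable_const (a := ())))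

lemma measurable_extend :
    Measurable fun x : PartialTraj S A × A × ℝ × S => extend x.1 x.2.1 x.2.2.1 x.2.2.2 := by
  refine measurable_of_mk fun t => (measurable_mk (t + 1)).comp (Measurable.prodMk ?_ (by fun_prop))
  refine measurable_pi_lambda _ fun i => ?_
  refine Fin.lastCases ?_ (fun j => ?_) i
  · simp only [Fin.snoc_last, last]
    fun_prop
  · simp only [Fin.snoc_castSucc]
    fun_prop

end PartialTraj

/-- The MDP on partial trajectories induced by `M`: in state `l`, the action `a` yields the reward
`r = R(last l, a)`, and the next state is `l` extended by `a`, `r` and `s' ∼ P(· | last l, a)`. -/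
def MDP.augment {S : Type u} {A : Type v} [MeasurableSpace S] [MeasurableSpace A]
    (M : MDP S A) : MDP (PartialTraj S A) A where
  trans := (Kernel.id ×ₖ M.trans.comap (fun x : PartialTraj S A × A => (x.1.last, x.2))
      (by have := PartialTraj.measurable_last (S := S) (A := A); fun_prop)).map
    (fun y : (PartialTraj S A × A) × S =>
      y.1.1.extend y.1.2 (M.reward y.1.1.last y.1.2) y.2)
  isMarkov := by
    have h1 := PartialTraj.measurable_last (S := S) (A := A)
    have h2 := PartialTraj.measurable_extend (S := S) (A := A)
    have h3 := M.measurable_reward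
    refine Kernel.IsMarkovKernel.map _ (h2.comp (f := fun y : (PartialTraj S A × A) × S =>
      (y.1.1, y.1.2, M.reward y.1.1.last y.1.2, y.2)) ?_)
    have h4 : Measurable fun y : (PartialTraj S A × A) × S => M.reward y.1.1.last y.1.2 :=
      h3.comp ((h1.comp (by fun_prop)).prodMk (by fun_prop))
    fun_prop
  reward l a := M.reward l.last a
  measurable_reward :=
    M.measurable_reward.comp
      ((PartialTraj.measurable_last.comp measurable_fst).prodMk measurable_snd)
  γ := M.γ
  γ_pos := M.γ_pos
  γ_lt_one := M.γ_lt_one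

/-- A distribution over tasks sharing the states, actions, initial distribution, dynamics and
discount factor. Tasks are labelled by `Θ`; task `θ` has reward function `reward θ`. -/
structure TaskDistribution (Θ : Type w) (S : Type u) (A : Type v)
    [MeasurableSpace Θ] [MeasurableSpace S] [MeasurableSpace A] where
  prior : Measure Θ
  isProb_prior : IsProbabilityMeasure prior
  init : Measure S
  isProb_init : IsProbabilityMeasure init
  trans : Kernel (S × A) S
  isMarkov : IsMarkovKernel trans
  reward : Θ → S → A → ℝ
  measurable_reward : Measurable fun x : Θ × S × A => reward x.1 x.2.1 x.2.2
  γ : ℝ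
  γ_pos : 0 < γ
  γ_lt_one : γ < 1

attribute [instance] TaskDistribution.isProb_prior TaskDistribution.isProb_init
  TaskDistribution.isMarkov

namespace TaskDistribution

variable {Θ : Type w} {S : Type u} {A : Type v}
  [MeasurableSpace Θ] [MeasurableSpace S] [MeasurableSpace A]

/-- The MDP of task `θ`. -/
def task (𝒯 : TaskDistribution Θ S A) (θ : Θ) : MDP S A where
  trans := 𝒯.trans
  isMarkov := 𝒯.isMarkov
  reward := 𝒯.reward θ
  measurable_reward := 𝒯.measurable_reward.comp (measurable_const.prodMk measurable_id)
  γ := 𝒯.γ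
  γ_pos := 𝒯.γ_pos
  γ_lt_one := 𝒯.γ_lt_one

/-- Initial distribution on partial trajectories. -/
def augInit (𝒯 : TaskDistribution Θ S A) : Measure (PartialTraj S A) :=
  𝒯.init.map PartialTraj.start

instance (𝒯 : TaskDistribution Θ S A) : IsProbabilityMeasure 𝒯.augInit :=
  Measure.isProbabilityMeasure_map PartialTraj.measurable_start.aemeasurable

/-- `J_M(π)` for a reward-informed history policy `π`. -/
def J (𝒯 : TaskDistribution Θ S A) (π : Kernel (PartialTraj S A) A) [IsMarkovKernel π]
    (θ : Θ) : ℝ :=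
  (𝒯.task θ).augment.J 𝒯.augInit π

/-- `max_π J_M(π)`. -/
def Jstar (𝒯 : TaskDistribution Θ S A) (θ : Θ) : ℝ :=
  (𝒯.task θ).augment.Jstar 𝒯.augInit

/-- `Q*_M(l, a)`. -/
def Qstar (𝒯 : TaskDistribution Θ S A) (θ : Θ) (l : PartialTraj S A) (a : A) : ℝ :=
  (𝒯.task θ).augment.Qstar l a

/-- One step of the state-action chains of all tasks, as a kernel in the task as well. -/
def jointStep (𝒯 : TaskDistribution Θ S A) (π : Kernel (PartialTraj S A) A) :
    Kernel (Θ × PartialTraj S A × A) (PartialTraj S A × A) :=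
  (Kernel.id ×ₖ π) ∘ₖ (Kernel.id ×ₖ 𝒯.trans.comap
      (fun x : Θ × PartialTraj S A × A => (x.2.1.last, x.2.2))
      (by have := PartialTraj.measurable_last (S := S) (A := A); fun_prop)).map
    (fun y : (Θ × PartialTraj S A × A) × S =>
      y.1.2.1.extend y.1.2.2 (𝒯.reward y.1.1 y.1.2.1.last y.1.2.2) y.2)

lemma jointStep_apply (𝒯 : TaskDistribution Θ S A) (π : Kernel (PartialTraj S A) A)
    (x : Θ × PartialTraj S A × A) :
    𝒯.jointStep π x = (𝒯.task x.1).augment.step π x.2 := by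
  have h1 := PartialTraj.measurable_last (S := S) (A := A)
  have h2 := PartialTraj.measurable_extend (S := S) (A := A)
  have h4 : Measurable fun y : (Θ × PartialTraj S A × A) × S =>
      𝒯.reward y.1.1 y.1.2.1.last y.1.2.2 :=
    𝒯.measurable_reward.comp ((by fun_prop : Measurable
      fun y : (Θ × PartialTraj S A × A) × S => (y.1.1, y.1.2.1.last, y.1.2.2)))
  have h5 : Measurable fun y : (PartialTraj S A × A) × S =>
      𝒯.reward x.1 y.1.1.last y.1.2 :=
    𝒯.measurable_reward.comp ((by fun_prop : Measurable
      fun y : (PartialTraj S A × A) × S => (x.1, y.1.1.last, y.1.2)))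
  have h6 : Measurable (fun y : (Θ × PartialTraj S A × A) × S =>
      y.1.2.1.extend y.1.2.2 (𝒯.reward y.1.1 y.1.2.1.last y.1.2.2) y.2) :=
    h2.comp (f := fun y : (Θ × PartialTraj S A × A) × S =>
      (y.1.2.1, y.1.2.2, 𝒯.reward y.1.1 y.1.2.1.last y.1.2.2, y.2)) (by fun_prop)
  have h7 : Measurable (fun y : (PartialTraj S A × A) × S =>
      y.1.1.extend y.1.2 (𝒯.reward x.1 y.1.1.last y.1.2) y.2) :=
    h2.comp (f := fun y : (PartialTraj S A × A) × S =>
      (y.1.1, y.1.2, 𝒯.reward x.1 y.1.1.last y.1.2, y.2)) (by fun_prop)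
  rw [jointStep, MDP.step, Kernel.comp_apply, Kernel.comp_apply]
  congr 1
  rw [Kernel.map_apply _ h6]
  change _ = (Kernel.map _ (fun y : (PartialTraj S A × A) × S =>
      y.1.1.extend y.1.2 (𝒯.reward x.1 y.1.1.last y.1.2) y.2)) x.2
  rw [Kernel.map_apply _ h7, Kernel.prod_apply, Kernel.prod_apply, Kernel.id_apply,
    Kernel.id_apply, Measure.dirac_prod, Measure.dirac_prod,
    Measure.map_map h6 (by fun_prop), Measure.map_map h7 (by fun_prop)]
  rfl

lemma measurable_occupancy (𝒯 : TaskDistribution Θ S A) (π : Kernel (PartialTraj S A) A)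
    [IsMarkovKernel π] : Measurable fun θ => (𝒯.task θ).augment.occupancy 𝒯.augInit π := by
  have hpath : ∀ t, Measurable fun θ => ((𝒯.task θ).augment.pathLaw π (𝒯.augInit ⊗ₘ π)).map
      (fun ω => ω t) := by
    intro t
    induction t with
    | zero => simp only [MDP.pathLaw_map_zero, measurable_const]
    | succ t ih =>
      let κ : Kernel Θ (PartialTraj S A × A) := ⟨_, ih⟩
      have : IsMarkovKernel κ := ⟨fun θ => by
        change IsProbabilityMeasure (Measure.map _ _)
        exact Measure.isProbabilityMeasure_map (measurable_pi_apply t).aemeasurable⟩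
      convert (𝒯.jointStep π ∘ₖ (Kernel.id ×ₖ κ)).measurable using 2 with θ
      rw [MDP.pathLaw_map_succ, Kernel.comp_apply, Kernel.prod_apply, Kernel.id_apply,
        Measure.dirac_prod]
      ext B hB
      rw [Measure.bind_apply hB (Kernel.aemeasurable _),
        Measure.bind_apply hB (Kernel.aemeasurable _),
        lintegral_map (μ := κ θ) (Kernel.measurable_coe _ hB) (by fun_prop)]
      simp only [jointStep_apply]
      rfl
  have hstate : ∀ t, Measurable fun θ => (𝒯.task θ).augment.stateLaw 𝒯.augInit π t := by
    intro t
    have := (Measure.measurable_map (Prod.fst : PartialTraj S A × A → _) measurable_fst).comp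
      (hpath t)
    convert this using 2 with θ
    rw [Function.comp_apply, Measure.map_map measurable_fst (measurable_pi_apply t)]
    rfl
  refine Measure.measurable_of_measurable_coe _ fun B hB => ?_
  simp only [MDP.occupancy, Measure.sum_apply _ hB, Measure.smul_apply, smul_eq_mul]
  exact Measurable.tsum fun t =>
    (measurable_const : Measurable fun _ : Θ => ENNReal.ofReal ((1 - 𝒯.γ) * 𝒯.γ ^ t)).mul
      ((Measure.measurable_coe hB).comp (hstate t))

/-- The discounted occupancy of `π` over partial trajectories, given the task. -/
def occupancy (𝒯 : TaskDistribution Θ S A) (π : Kernel (PartialTraj S A) A)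
    [IsMarkovKernel π] : Kernel Θ (PartialTraj S A) where
  toFun θ := (𝒯.task θ).augment.occupancy 𝒯.augInit π
  measurable' := 𝒯.measurable_occupancy π

instance (𝒯 : TaskDistribution Θ S A) (π : Kernel (PartialTraj S A) A) [IsMarkovKernel π] :
    IsMarkovKernel (𝒯.occupancy π) :=
  ⟨fun θ => inferInstanceAs
    (IsProbabilityMeasure ((𝒯.task θ).augment.occupancy 𝒯.augInit π))⟩

/-- The distribution `p(l) = ∫ p(M) d_{M,π}(l) dM` on partial trajectories. -/
def trajDist (𝒯 : TaskDistribution Θ S A) (π : Kernel (PartialTraj S A) A)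
    [IsMarkovKernel π] : Measure (PartialTraj S A) :=
  𝒯.occupancy π ∘ₘ 𝒯.prior

/-- The task posterior `p(M | l)`, the conditional law of the task `M` given `l` under the joint law
`p(M) d_{M,π}(l)`. -/
def taskPosterior [StandardBorelSpace Θ] [Nonempty Θ] (𝒯 : TaskDistribution Θ S A)
    (π : Kernel (PartialTraj S A) A) [IsMarkovKernel π] : Kernel (PartialTraj S A) Θ :=
  posterior (𝒯.occupancy π) 𝒯.prior

end TaskDistribution

end

/-! Fix a task and an optimal policy σ for it. By the Bellman equation Q = r + γ P V, the mean of
V_σ - ∫ Q_σ dπ under the time-`t` state law of π is v_t - r_t - γ v_{t+1}. Here v_t is the mean of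
V_σ and r_t the mean reward of π at time t. Discounting and summing telescopes to v_0 - J(π), which
is the performance difference lemma `MDP.integral_V_sub_J`. Optimality from every state gives Q_σ =
Q* and V_σ = max_a Q* (`IsOptimal.Qstar_eq`, `IsOptimal.iSup_Qstar_eq`), so this is the exact gap J*
- J(π) of one task.

Averaging over tasks integrates against the joint law of task and partial trajectory, which Bayes'
rule (`integral_trajDist_taskPosterior`) disintegrates into p(dl) and the posterior. Since π sees
only l, task and action are independent given l. The average of the posterior mean of Q* over π(· |
l) cannot exceed its supremum over actions, whence the lower bound.

That supremum ranges over uncountably many actions and need not be Borel in l. Its superlevel sets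
are projections of Borel sets, hence analytic and universally measurable. By contrast max_a Q* is
measurable because it equals V_σ. -/

noncomputable section

/-! ### Universal measurability of analytic sets and of suprema. -/

lemma isCompact_setOf_forall_le (n : ℕ → ℕ) : IsCompact {x : ℕ → ℕ | ∀ i, x i ≤ n i} := by
  have : {x : ℕ → ℕ | ∀ i, x i ≤ n i} = Set.univ.pi fun i => Set.Iic (n i) := by
    ext; simp [Pi.le_def]
  rw [this]
  exact isCompact_univ_pi fun i => (Set.finite_Iic (n i)).isCompact

/-- An open neighbourhood of the compact box `{x | ∀ i, x i ≤ n i}` in `ℕ → ℕ` contains a cylinder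
`{x | ∀ i < k, x i ≤ n i}`. -/
lemma exists_cylinder_subset_of_isOpen {n : ℕ → ℕ} {V : Set (ℕ → ℕ)} (hV : IsOpen V)
    (h : {x | ∀ i, x i ≤ n i} ⊆ V) : ∃ k, {x : ℕ → ℕ | ∀ i < k, x i ≤ n i} ⊆ V := by
  by_contra! hcon
  have hcon' : ∀ k, ∃ x : ℕ → ℕ, (∀ i < k, x i ≤ n i) ∧ x ∉ V := fun k => by
    simpa [Set.not_subset] using hcon k
  choose x hx hxV using hcon'
  -- Truncating `x k` by `n` moves it into the box and leaves its first `k` coordinates unchanged,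
  -- so the truncated and original subsequences have the same limit.
  obtain ⟨y, hy, φ, hφ, hlim⟩ := (isCompact_setOf_forall_le n).tendsto_subseq
    (x := fun k i => min (x k i) (n i)) (fun k i => min_le_right _ _)
  have hlim' : Filter.Tendsto (fun k => x (φ k)) Filter.atTop (nhds y) := by
    rw [tendsto_pi_nhds] at hlim ⊢
    intro i
    refine (hlim i).congr' ?_
    filter_upwards [Filter.eventually_gt_atTop i] with k hk
    exact min_eq_left (hx _ i (hk.trans_le (hφ.id_le k)))
  exact hV.isClosed_compl.mem_of_tendsto hlim' (Filter.Eventually.of_forall fun k => hxV _) (h hy)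

/-- Inner approximation of analytic sets by compact sets. -/
lemma MeasureTheory.AnalyticSet.exists_isCompact_measure_le {α : Type*} [TopologicalSpace α]
    [T2Space α] [MeasurableSpace α] (μ : Measure α) [IsFiniteMeasure μ]
    [μ.OuterRegular] {s : Set α} (hs : AnalyticSet s) {ε : ℝ≥0∞} (hε : ε ≠ 0) :
    ∃ K ⊆ s, IsCompact K ∧ μ s ≤ μ K + ε := by
  rw [AnalyticSet] at hs
  obtain rfl | ⟨f, hf, rfl⟩ := hs
  · exact ⟨∅, subset_rfl, isCompact_empty, by simp⟩
  obtain ⟨δ, hδ, hδε⟩ := ENNReal.exists_pos_sum_of_countable' hε ℕ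
  -- Bounding coordinate `k` by a large enough `m` costs at most `δ k` of outer measure. Continuity
  -- from below along increasing sets holds for outer measure, so the images need not be measurable.
  have hstep : ∀ (E : Set (ℕ → ℕ)) (k : ℕ), ∃ m : ℕ,
      μ (f '' E) ≤ μ (f '' (E ∩ {x | x k ≤ m})) + δ k := by
    intro E k
    have hE : f '' E = ⋃ m : ℕ, f '' (E ∩ {x | x k ≤ m}) := by
      rw [← Set.image_iUnion, ← Set.inter_iUnion]
      congr 1
      ext x
      simp only [Set.mem_inter_iff, Set.mem_iUnion, Set.mem_ofPred_eq]
      exact ⟨fun h => ⟨h, x k, le_rfl⟩, fun h => h.1⟩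
    have hmono : Monotone fun m : ℕ => f '' (E ∩ {x | x k ≤ m}) := fun a b hab =>
      Set.image_mono (Set.inter_subset_inter_right _ fun x (hx : x k ≤ a) => hx.trans hab)
    have hlim := tendsto_measure_iUnion_atTop (μ := μ) hmono
    rw [← hE] at hlim
    by_cases h0 : μ (f '' E) = 0
    · exact ⟨0, by simp [h0]⟩
    · have hlt : μ (f '' E) - δ k < μ (f '' E) :=
        ENNReal.sub_lt_self (measure_ne_top _ _) h0 (hδ k).ne'
      obtain ⟨m, hm⟩ := (hlim.eventually (lt_mem_nhds hlt)).exists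
      exact ⟨m, tsub_le_iff_right.1 hm.le⟩
  choose m hm using hstep
  let E : ℕ → Set (ℕ → ℕ) := fun k =>
    Nat.rec Set.univ (fun k E => E ∩ {x | x k ≤ m E k}) k
  have hEsucc : ∀ k, E (k + 1) = E k ∩ {x | x k ≤ m (E k) k} := fun k => rfl
  have hEmeas : ∀ k, μ (Set.range f) ≤ μ (f '' E k) + ∑ i ∈ Finset.range k, δ i := by
    intro k
    induction k with
    | zero => simp [E]
    | succ k ih =>
      rw [Finset.sum_range_succ, hEsucc, add_comm (∑ i ∈ Finset.range k, δ i), ← add_assoc]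
      exact ih.trans (by gcongr; exact hm _ _)
  have hEcyl : ∀ k, {x : ℕ → ℕ | ∀ i < k, x i ≤ m (E i) i} = E k := by
    intro k
    induction k with
    | zero => simp [E]
    | succ k ih =>
      ext x
      rw [hEsucc, Set.mem_inter_iff, ← Set.ext_iff.1 ih x]
      exact Nat.forall_lt_succ_right
  refine ⟨f '' {x | ∀ i, x i ≤ m (E i) i}, Set.image_subset_range _ _, (isCompact_setOf_forall_le _).image hf, ?_⟩
  have hfin : μ (f '' {x | ∀ i, x i ≤ m (E i) i}) ≠ ∞ := measure_ne_top _ _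
  refine le_of_forall_gt fun c hc => ?_
  have hc' : μ (f '' {x | ∀ i, x i ≤ m (E i) i}) < c - ε := lt_tsub_iff_right.2 hc
  -- An open `U` around the compact image already contains the image of a finite-stage cylinder `E
  -- k`, where at most `ε` has been lost. This replaces continuity from above, which would require
  -- measurability.
  obtain ⟨U, hKU, hU, hUc⟩ := Set.exists_isOpen_lt_of_lt _ _ hc'
  obtain ⟨k, hk⟩ := exists_cylinder_subset_of_isOpen (hU.preimage hf) (Set.image_subset_iff.1 hKU)
  rw [hEcyl] at hk
  calc μ (Set.range f) ≤ μ (f '' E k) + ∑ i ∈ Finset.range k, δ i := hEmeas k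
    _ ≤ μ U + ε := add_le_add (measure_mono (Set.image_subset_iff.2 hk))
        ((ENNReal.sum_le_tsum _).trans hδε.le)
    _ < c := lt_tsub_iff_right.1 hUc

/-- Analytic sets are universally measurable. -/
theorem MeasureTheory.AnalyticSet.nullMeasurableSet {α : Type*} [TopologicalSpace α]
    [T2Space α] [MeasurableSpace α] [OpensMeasurableSpace α] (μ : Measure α) [IsFiniteMeasure μ]
    [μ.OuterRegular] {s : Set α} (hs : AnalyticSet s) : NullMeasurableSet s μ := by
  choose K hKs hK hle using fun n : ℕ => hs.exists_isCompact_measure_le μ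
    (ε := ((n : ℝ≥0∞) + 1)⁻¹) (by simp)
  have hmeas : MeasurableSet (⋃ n, K n) :=
    MeasurableSet.iUnion fun n => (hK n).isClosed.measurableSet
  have hsub : (⋃ n, K n) ⊆ s := Set.iUnion_subset hKs
  have hge : μ s ≤ μ (⋃ n, K n) := by
    have hlim : Filter.Tendsto (fun n : ℕ => μ (⋃ n, K n) + ((n : ℝ≥0∞) + 1)⁻¹) Filter.atTop
        (nhds (μ (⋃ n, K n) + 0)) := by
      refine tendsto_const_nhds.add ?_
      have := (Filter.tendsto_add_atTop_iff_nat 1).2 ENNReal.tendsto_inv_nat_nhds_zero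
      simpa using this
    rw [add_zero] at hlim
    exact ge_of_tendsto' hlim fun n => (hle n).trans
      (by gcongr; exact Set.subset_iUnion K n)
  exact hmeas.nullMeasurableSet.congr
    (ae_eq_of_subset_of_measure_ge hsub hge hmeas.nullMeasurableSet (measure_ne_top _ _))

/-- The supremum over a standard Borel parameter of a jointly measurable function is universally
measurable. -/
theorem aemeasurable_iSup_of_standardBorel {X Y : Type*} [MeasurableSpace X]
    [StandardBorelSpace X] [MeasurableSpace Y] [StandardBorelSpace Y] {g : X × Y → EReal}
    (hg : Measurable g) (μ : Measure X) [IsFiniteMeasure μ] :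
    AEMeasurable (fun x => ⨆ y, g (x, y)) μ := by
  let := upgradeStandardBorel X
  refine NullMeasurable.aemeasurable fun t ht => ?_
  have hgen : NullMeasurable (fun x => ⨆ y, g (x, y)) μ := by
    have : Measurable[NullMeasurableSpace.instMeasurableSpace (μ := μ)]
        (fun x : NullMeasurableSpace X μ => ⨆ y, g (x, y)) := by
      refine measurable_of_Ioi fun c => ?_
      -- The strict inequality makes the superlevel set exactly a projection, hence analytic.
      have himg : (fun x : NullMeasurableSpace X μ => ⨆ y, g (x, y)) ⁻¹' Set.Ioi c =
          Prod.fst '' (g ⁻¹' Set.Ioi c) := by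
        ext x
        simp only [Set.mem_preimage, Set.mem_Ioi, lt_iSup_iff]
        exact ⟨fun ⟨y, hy⟩ => ⟨(x, y), hy, rfl⟩, fun ⟨p, hp, he⟩ => ⟨p.2, by rw [← he]; exact hp⟩⟩
      rw [himg]
      exact ((hg measurableSet_Ioi).analyticSet_image measurable_fst).nullMeasurableSet μ
    exact fun s hs => this hs
  exact hgen ht

/-- A countable disjoint union of standard Borel spaces is standard Borel. -/
instance StandardBorelSpace.sigma_countable {ι : Type*} [Countable ι] {α : ι → Type*}
    [∀ i, MeasurableSpace (α i)] [∀ i, StandardBorelSpace (α i)] :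
    StandardBorelSpace (Σ i, α i) := by
  let : ∀ i, UpgradedStandardBorel (α i) := fun i => upgradeStandardBorel (α i)
  -- The sum σ-algebra is the Borel σ-algebra of the disjoint union topology, which is Polish for
  -- countably many Polish summands.
  have hborel : BorelSpace (Σ i, α i) := by
    refine ⟨le_antisymm (fun s hs => ?_) (MeasurableSpace.generateFrom_le fun s hs => ?_)⟩
    · have hs' : ∀ i, MeasurableSet (Sigma.mk i ⁻¹' s) :=
        fun i => MeasurableSpace.measurableSet_iInf.1 hs i
      have hun : s = ⋃ i, Sigma.mk i '' (Sigma.mk i ⁻¹' s) := by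
        ext ⟨i, x⟩
        simp only [Set.mem_iUnion, Set.mem_image, Set.mem_preimage]
        exact ⟨fun h => ⟨i, x, h, rfl⟩, fun ⟨j, y, hy, he⟩ => he ▸ hy⟩
      rw [hun]
      let : MeasurableSpace (Σ i, α i) := borel _
      have : BorelSpace (Σ i, α i) := ⟨rfl⟩
      exact MeasurableSet.iUnion fun i =>
        (Topology.IsOpenEmbedding.sigmaMk (i := i)).measurableEmbedding.measurableSet_image' (hs' i)
    · exact MeasurableSpace.measurableSet_iInf.2 fun i =>
        (IsOpen.preimage continuous_sigmaMk hs).measurableSet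
  infer_instance

lemma integrable_of_abs_le {X : Type*} [MeasurableSpace X] {μ : Measure X} [IsFiniteMeasure μ]
    {f : X → ℝ} (hf : Measurable f) {C : ℝ} (hC : ∀ x, |f x| ≤ C) : Integrable f μ :=
  Integrable.of_bound hf.aestronglyMeasurable C (Filter.Eventually.of_forall hC)

lemma abs_integral_le_of_abs_le {X : Type*} [MeasurableSpace X] {μ : Measure X}
    [IsProbabilityMeasure μ] {f : X → ℝ} {C : ℝ} (hC : ∀ x, |f x| ≤ C) : |∫ x, f x ∂μ| ≤ C := by
  simpa using norm_integral_le_of_norm_le_const (μ := μ) (f := f)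
    (Filter.Eventually.of_forall hC)

lemma ProbabilityTheory.integral_measure_comp {X Y : Type*} [MeasurableSpace X]
    [MeasurableSpace Y] {μ : Measure X} {κ : Kernel X Y} {f : Y → ℝ}
    (hf : Integrable f (κ ∘ₘ μ)) : ∫ y, f y ∂(κ ∘ₘ μ) = ∫ x, ∫ y, f y ∂κ x ∂μ := by
  rw [Measure.comp_eq_comp_const_apply] at hf ⊢
  rw [Kernel.integral_comp hf, Kernel.const_apply]

/-! ### Values, Bellman equation and performance difference for bounded rewards. -/

namespace MDP

section General

variable {X : Type u} {A : Type v} [MeasurableSpace X] [MeasurableSpace A]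

/-- The `t`-step transition kernel of the state-action chain. -/
def stepIter (M : MDP X A) (π : Kernel X A) : ℕ → Kernel (X × A) (X × A)
  | 0 => Kernel.id
  | t + 1 => M.step π ∘ₖ M.stepIter π t

instance isMarkovKernel_stepIter (M : MDP X A) (π : Kernel X A) [IsMarkovKernel π] (t : ℕ) :
    IsMarkovKernel (M.stepIter π t) := by
  induction t with
  | zero => rw [stepIter]; infer_instance
  | succ t ih => rw [stepIter]; infer_instance

/-- The definition peels off the last step; the Bellman equation needs the first one. -/
lemma stepIter_succ_eq_comp_step (M : MDP X A) (π : Kernel X A) (t : ℕ) :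
    M.stepIter π (t + 1) = M.stepIter π t ∘ₖ M.step π := by
  induction t with
  | zero => simp [stepIter]
  | succ t ih => rw [stepIter, ih, ← Kernel.comp_assoc, ← stepIter, ih]

/-- The expected return depends only on one-time marginals, so this replaces the path measure by
kernel iterates. -/
lemma pathLaw_map_eval (M : MDP X A) (π : Kernel X A) [IsMarkovKernel π] (μ : Measure (X × A))
    [IsProbabilityMeasure μ] (t : ℕ) :
    (M.pathLaw π μ).map (fun ω => ω t) = M.stepIter π t ∘ₘ μ := by
  induction t with
  | zero => rw [pathLaw_map_zero, stepIter, Measure.id_comp]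
  | succ t ih => rw [pathLaw_map_succ, ih, stepIter, Measure.comp_assoc]

lemma step_apply (M : MDP X A) (π : Kernel X A) [IsMarkovKernel π] (z : X × A) :
    M.step π z = M.trans z ⊗ₘ π := by
  rw [step, Kernel.comp_apply, Measure.compProd_eq_comp_prod]

/-- The expected reward after `t` steps of the state-action chain. -/
def meanReward (M : MDP X A) (π : Kernel X A) (t : ℕ) (z : X × A) : ℝ :=
  ∫ y, M.reward y.1 y.2 ∂M.stepIter π t z

lemma measurable_uncurried_reward (M : MDP X A) :
    Measurable fun y : X × A => M.reward y.1 y.2 := M.measurable_reward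

lemma measurable_meanReward (M : MDP X A) (π : Kernel X A) [IsMarkovKernel π] (t : ℕ) :
    Measurable (M.meanReward π t) :=
  (M.measurable_uncurried_reward.stronglyMeasurable.integral_kernel
    (κ := M.stepIter π t)).measurable

lemma abs_meanReward_le (M : MDP X A) (π : Kernel X A) [IsMarkovKernel π] {C : ℝ}
    (hC : ∀ x a, |M.reward x a| ≤ C) (t : ℕ) (z : X × A) : |M.meanReward π t z| ≤ C :=
  abs_integral_le_of_abs_le fun y => hC y.1 y.2

lemma integral_reward_stepIter_comp (M : MDP X A) (π : Kernel X A) [IsMarkovKernel π] {C : ℝ}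
    (hC : ∀ x a, |M.reward x a| ≤ C) (t : ℕ) (μ : Measure (X × A)) [IsProbabilityMeasure μ] :
    ∫ y, M.reward y.1 y.2 ∂(M.stepIter π t ∘ₘ μ) = ∫ z, M.meanReward π t z ∂μ :=
  integral_measure_comp
    (integrable_of_abs_le M.measurable_uncurried_reward fun y => hC y.1 y.2)

lemma summable_pow_mul_of_abs_le (M : MDP X A) {C : ℝ} {f : ℕ → ℝ} (hf : ∀ t, |f t| ≤ C) :
    Summable fun t => M.γ ^ t * f t := by
  refine Summable.of_norm_bounded
    ((summable_geometric_of_lt_one M.γ_pos.le M.γ_lt_one).mul_right C) fun t => ?_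
  rw [Real.norm_eq_abs, abs_mul, abs_of_nonneg (pow_nonneg M.γ_pos.le t)]
  exact mul_le_mul_of_nonneg_left (hf t) (pow_nonneg M.γ_pos.le t)

lemma abs_le_of_hasSum_pow_mul (M : MDP X A) {C s : ℝ} {f : ℕ → ℝ} (hf : ∀ t, |f t| ≤ C)
    (hs : HasSum (fun t => M.γ ^ t * f t) s) : |s| ≤ C / (1 - M.γ) := by
  have hgeo := (hasSum_geometric_of_lt_one M.γ_pos.le M.γ_lt_one).mul_right C
  have h := hs.norm_le_of_bounded hgeo fun t => by
    rw [Real.norm_eq_abs, abs_mul, abs_of_nonneg (pow_nonneg M.γ_pos.le t)]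
    exact mul_le_mul_of_nonneg_left (hf t) (pow_nonneg M.γ_pos.le t)
  rwa [Real.norm_eq_abs, inv_mul_eq_div] at h

/-- The geometric bound `C * γ ^ t` justifies exchanging sum and integral. -/
lemma hasSum_integral_pow_mul (M : MDP X A) {Y : Type*} [MeasurableSpace Y] {μ : Measure Y}
    [IsProbabilityMeasure μ] {f : ℕ → Y → ℝ} (hf : ∀ t, Measurable (f t)) {C : ℝ}
    (hC : ∀ t y, |f t y| ≤ C) :
    HasSum (fun t => M.γ ^ t * ∫ y, f t y ∂μ) (∫ y, ∑' t, M.γ ^ t * f t y ∂μ) := by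
  have h := hasSum_integral_of_summable_integral_norm (μ := μ)
    (F := fun t y => M.γ ^ t * f t y)
    (fun t => (integrable_of_abs_le (hf t) (hC t)).const_mul _) ?_
  · simpa only [integral_const_mul] using h
  · simp only [norm_mul, integral_const_mul, norm_pow, Real.norm_eq_abs, abs_of_pos M.γ_pos]
    refine M.summable_pow_mul_of_abs_le (C := C) fun t => ?_
    exact abs_integral_le_of_abs_le fun y => by rw [abs_abs]; exact hC t y

lemma hasSum_integral_discountedReturn (M : MDP X A) (π : Kernel X A) [IsMarkovKernel π] {C : ℝ}
    (hC : ∀ x a, |M.reward x a| ≤ C) (μ : Measure (X × A)) [IsProbabilityMeasure μ] :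
    HasSum (fun t => M.γ ^ t * ∫ z, M.meanReward π t z ∂μ)
      (∫ ω, M.discountedReturn ω ∂M.pathLaw π μ) := by
  have h := M.hasSum_integral_pow_mul (μ := M.pathLaw π μ)
    (f := fun t ω => M.reward (ω t).1 (ω t).2)
    (fun t => M.measurable_uncurried_reward.comp (measurable_pi_apply t)) (fun t ω => hC _ _)
  refine HasSum.congr_fun h fun t => ?_
  rw [← M.integral_reward_stepIter_comp π hC, ← pathLaw_map_eval,
    integral_map (measurable_pi_apply t).aemeasurable
      M.measurable_uncurried_reward.aestronglyMeasurable]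

lemma hasSum_Q (M : MDP X A) (π : Kernel X A) [IsMarkovKernel π] {C : ℝ}
    (hC : ∀ x a, |M.reward x a| ≤ C) (x : X) (a : A) :
    HasSum (fun t => M.γ ^ t * M.meanReward π t (x, a)) (M.Q π x a) := by
  have h := M.hasSum_integral_discountedReturn π hC (Measure.dirac (x, a))
  simp only [integral_dirac' _ _ (M.measurable_meanReward π _).stronglyMeasurable] at h
  exact h

lemma abs_Q_le (M : MDP X A) (π : Kernel X A) [IsMarkovKernel π] {C : ℝ}
    (hC : ∀ x a, |M.reward x a| ≤ C) (x : X) (a : A) : |M.Q π x a| ≤ C / (1 - M.γ) :=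
  M.abs_le_of_hasSum_pow_mul (fun t => M.abs_meanReward_le π hC t (x, a)) (M.hasSum_Q π hC x a)

/-- Joint measurability of the state-action values of a measurable family of decision processes
and policies. -/
lemma measurable_Q_family {Θ : Type*} [MeasurableSpace Θ] (M : Θ → MDP X A)
    (σ : Θ → Kernel X A) [∀ θ, IsMarkovKernel (σ θ)]
    (hstep : Measurable fun p : Θ × X × A => (M p.1).step (σ p.1) p.2)
    (hr : Measurable fun p : Θ × X × A => (M p.1).reward p.2.1 p.2.2)
    (hγ : Measurable fun θ => (M θ).γ) {C : Θ → ℝ} (hC : ∀ θ x a, |(M θ).reward x a| ≤ C θ) :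
    Measurable fun p : Θ × X × A => (M p.1).Q (σ p.1) p.2.1 p.2.2 := by
  let S : Kernel (Θ × X × A) (X × A) := ⟨_, hstep⟩
  have hS : IsMarkovKernel S :=
    ⟨fun p => inferInstanceAs (IsProbabilityMeasure ((M p.1).step (σ p.1) p.2))⟩
  have hiter : ∀ t, Measurable fun p : Θ × X × A => (M p.1).stepIter (σ p.1) t p.2 := by
    intro t
    induction t with
    | zero => exact (Kernel.id (α := X × A)).measurable.comp measurable_snd
    | succ t ih =>
      let κ : Kernel (Θ × X × A) (X × A) := ⟨_, ih⟩
      have hκ : IsMarkovKernel κ :=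
        ⟨fun p => inferInstanceAs (IsProbabilityMeasure ((M p.1).stepIter (σ p.1) t p.2))⟩
      -- The deterministic factor carries the parameter along, since the next step depends on it.
      convert (S ∘ₖ (Kernel.deterministic Prod.fst measurable_fst ×ₖ κ)).measurable using 2 with p
      rw [stepIter, Kernel.comp_apply, Kernel.comp_apply, Kernel.prod_apply,
        Kernel.deterministic_apply, Measure.dirac_prod]
      ext s hs
      rw [Measure.bind_apply hs (Kernel.aemeasurable _), Measure.bind_apply hs
        (Kernel.aemeasurable _), lintegral_map (Kernel.measurable_coe _ hs) (by fun_prop)]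
      rfl
  have hmean : ∀ t, Measurable fun p : Θ × X × A => (M p.1).meanReward (σ p.1) t p.2 := by
    intro t
    let κ : Kernel (Θ × X × A) (X × A) := ⟨_, hiter t⟩
    have hκ : IsMarkovKernel κ :=
      ⟨fun p => inferInstanceAs (IsProbabilityMeasure ((M p.1).stepIter (σ p.1) t p.2))⟩
    have hr' : Measurable fun q : (Θ × X × A) × X × A => (M q.1.1).reward q.2.1 q.2.2 :=
      hr.comp (by fun_prop : Measurable fun q : (Θ × X × A) × X × A => (q.1.1, q.2))
    exact (hr'.stronglyMeasurable.integral_kernel_prod_right' (κ := κ)).measurable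
  refine measurable_of_tendsto_metrizable (f := fun n (p : Θ × X × A) => ∑ t ∈ Finset.range n,
    (M p.1).γ ^ t * (M p.1).meanReward (σ p.1) t p.2) (fun n => ?_) ?_
  · exact Finset.measurable_fun_sum _ fun t _ =>
      ((hγ.comp measurable_fst).pow_const t).mul (hmean t)
  · rw [tendsto_pi_nhds]
    intro p
    exact ((M p.1).hasSum_Q (σ p.1) (hC p.1) p.2.1 p.2.2).tendsto_sum_nat

lemma measurable_Q (M : MDP X A) (π : Kernel X A) [IsMarkovKernel π] {C : ℝ}
    (hC : ∀ x a, |M.reward x a| ≤ C) : Measurable fun z : X × A => M.Q π z.1 z.2 :=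
  Measurable.comp (g := fun p : Unit × X × A => M.Q π p.2.1 p.2.2) (f := fun z => ((), z))
    (measurable_Q_family (fun _ => M) (fun _ => π) ((M.step π).measurable.comp measurable_snd)
      (M.measurable_uncurried_reward.comp measurable_snd) measurable_const fun _ => hC)
    (by fun_prop)

/-- Conditioning on the first state-action pair: both sides are sums of the same discounted series
of mean rewards. -/
lemma integral_discountedReturn_eq_integral_Q (M : MDP X A) (π : Kernel X A) [IsMarkovKernel π]
    {C : ℝ} (hC : ∀ x a, |M.reward x a| ≤ C) (μ : Measure (X × A)) [IsProbabilityMeasure μ] :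
    ∫ ω, M.discountedReturn ω ∂M.pathLaw π μ = ∫ z, M.Q π z.1 z.2 ∂μ := by
  have h := M.hasSum_integral_pow_mul (μ := μ) (f := M.meanReward π)
    (M.measurable_meanReward π) (M.abs_meanReward_le π hC)
  simp only [fun z : X × A => (M.hasSum_Q π hC z.1 z.2).tsum_eq] at h
  exact (M.hasSum_integral_discountedReturn π hC μ).unique h

lemma measurable_integral_Q (M : MDP X A) (π σ : Kernel X A) [IsMarkovKernel π] [IsMarkovKernel σ]
    {C : ℝ} (hC : ∀ x a, |M.reward x a| ≤ C) : Measurable fun x => ∫ a, M.Q σ x a ∂π x :=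
  ((M.measurable_Q σ hC).stronglyMeasurable.integral_kernel_prod_right' (κ := π)).measurable

lemma integral_Q_compProd (M : MDP X A) (π σ : Kernel X A) [IsMarkovKernel π] [IsMarkovKernel σ]
    {C : ℝ} (hC : ∀ x a, |M.reward x a| ≤ C) (ρ : Measure X) [IsProbabilityMeasure ρ] :
    ∫ z, M.Q σ z.1 z.2 ∂(ρ ⊗ₘ π) = ∫ x, ∫ a, M.Q σ x a ∂π x ∂ρ :=
  Measure.integral_compProd
    (integrable_of_abs_le (M.measurable_Q σ hC) fun z => M.abs_Q_le σ hC z.1 z.2)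

lemma V_eq_integral_Q (M : MDP X A) (π : Kernel X A) [IsMarkovKernel π] {C : ℝ}
    (hC : ∀ x a, |M.reward x a| ≤ C) (x : X) : M.V π x = ∫ a, M.Q π x a ∂π x := by
  rw [V, J, M.integral_discountedReturn_eq_integral_Q π hC, M.integral_Q_compProd π π hC,
    integral_dirac' _ _ (M.measurable_integral_Q π π hC).stronglyMeasurable]

lemma measurable_V (M : MDP X A) (π : Kernel X A) [IsMarkovKernel π] {C : ℝ}
    (hC : ∀ x a, |M.reward x a| ≤ C) : Measurable (M.V π) := by
  rw [funext (M.V_eq_integral_Q π hC)]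
  exact M.measurable_integral_Q π π hC

lemma abs_V_le (M : MDP X A) (π : Kernel X A) [IsMarkovKernel π] {C : ℝ}
    (hC : ∀ x a, |M.reward x a| ≤ C) (x : X) : |M.V π x| ≤ C / (1 - M.γ) := by
  rw [M.V_eq_integral_Q π hC]
  exact abs_integral_le_of_abs_le (M.abs_Q_le π hC x)

lemma integrable_V (M : MDP X A) (π : Kernel X A) [IsMarkovKernel π] {C : ℝ}
    (hC : ∀ x a, |M.reward x a| ≤ C) (ρ : Measure X) [IsFiniteMeasure ρ] :
    Integrable (M.V π) ρ :=
  integrable_of_abs_le (M.measurable_V π hC) (M.abs_V_le π hC)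

lemma J_eq_integral_V (M : MDP X A) (π : Kernel X A) [IsMarkovKernel π] {C : ℝ}
    (hC : ∀ x a, |M.reward x a| ≤ C) (ρ : Measure X) [IsProbabilityMeasure ρ] :
    M.J ρ π = ∫ x, M.V π x ∂ρ := by
  simp only [M.V_eq_integral_Q π hC]
  rw [J, M.integral_discountedReturn_eq_integral_Q π hC, M.integral_Q_compProd π π hC]

/-- The Bellman equation for the state-action values. -/
lemma Q_eq_reward_add (M : MDP X A) (π : Kernel X A) [IsMarkovKernel π] {C : ℝ}
    (hC : ∀ x a, |M.reward x a| ≤ C) (x : X) (a : A) :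
    M.Q π x a = M.reward x a + M.γ * ∫ x', M.V π x' ∂M.trans (x, a) := by
  -- Without its zeroth term, the series of `Q` is `γ` times the return series started from the law
  -- after one step.
  have h1 := (M.hasSum_integral_discountedReturn π hC (M.step π (x, a))).mul_left M.γ
  have h2 := (hasSum_nat_add_iff' 1).2 (M.hasSum_Q π hC x a)
  have h3 : ∀ t, M.γ ^ (t + 1) * M.meanReward π (t + 1) (x, a) =
      M.γ * (M.γ ^ t * ∫ z, M.meanReward π t z ∂M.step π (x, a)) := by
    intro t
    rw [← M.integral_reward_stepIter_comp π hC, meanReward, stepIter_succ_eq_comp_step,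
      Kernel.comp_apply, pow_succ]
    ring
  simp only [h3] at h2
  have h4 := h1.unique h2
  have h5 : M.meanReward π 0 (x, a) = M.reward x a := by
    rw [meanReward, stepIter, Kernel.id_apply,
      integral_dirac' _ _ M.measurable_uncurried_reward.stronglyMeasurable]
  rw [← M.J_eq_integral_V π hC, J, ← step_apply, h4]
  simp [h5]

/-- Law of the state-action pair at time `t`. -/
lemma stepIter_comp_eq_stateLaw_compProd (M : MDP X A) (ρ : Measure X) [IsProbabilityMeasure ρ]
    (π : Kernel X A) [IsMarkovKernel π] (t : ℕ) :
    M.stepIter π t ∘ₘ (ρ ⊗ₘ π) = M.stateLaw ρ π t ⊗ₘ π := by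
  have hfst : M.stateLaw ρ π t = (M.stepIter π t ∘ₘ (ρ ⊗ₘ π)).fst := by
    rw [← pathLaw_map_eval, Measure.fst, Measure.map_map measurable_fst (measurable_pi_apply t)]
    rfl
  -- Any such `ν` is forced to be the state law, by taking first marginals.
  suffices ∃ ν : Measure X, IsProbabilityMeasure ν ∧
      M.stepIter π t ∘ₘ (ρ ⊗ₘ π) = ν ⊗ₘ π by
    obtain ⟨ν, _, hν⟩ := this
    rw [hfst, hν, Measure.fst_compProd]
  cases t with
  | zero => exact ⟨ρ, inferInstance, by rw [stepIter, Measure.id_comp]⟩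
  | succ t =>
    refine ⟨M.trans ∘ₘ M.stepIter π t ∘ₘ (ρ ⊗ₘ π), inferInstance, ?_⟩
    rw [Measure.compProd_eq_comp_prod (M.trans ∘ₘ M.stepIter π t ∘ₘ (ρ ⊗ₘ π)),
      Measure.comp_assoc (η := Kernel.id ×ₖ π), ← step,
      Measure.comp_assoc, ← stepIter]

lemma stateLaw_zero (M : MDP X A) (ρ : Measure X) [IsProbabilityMeasure ρ]
    (π : Kernel X A) [IsMarkovKernel π] : M.stateLaw ρ π 0 = ρ := by
  have h := congrArg Measure.fst (M.stepIter_comp_eq_stateLaw_compProd ρ π 0)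
  rw [stepIter, Measure.id_comp, Measure.fst_compProd, Measure.fst_compProd] at h
  exact h.symm

lemma stateLaw_succ (M : MDP X A) (ρ : Measure X) [IsProbabilityMeasure ρ]
    (π : Kernel X A) [IsMarkovKernel π] (t : ℕ) :
    M.stateLaw ρ π (t + 1) = M.trans ∘ₘ (M.stateLaw ρ π t ⊗ₘ π) := by
  have h := congrArg Measure.fst (M.stepIter_comp_eq_stateLaw_compProd ρ π (t + 1))
  rw [Measure.fst_compProd, stepIter, ← Measure.comp_assoc,
    M.stepIter_comp_eq_stateLaw_compProd ρ π t, step, ← Measure.comp_assoc,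
    ← Measure.compProd_eq_comp_prod, Measure.fst_compProd] at h
  exact h.symm

lemma hasSum_integral_occupancy (M : MDP X A) (ρ : Measure X) [IsProbabilityMeasure ρ]
    (π : Kernel X A) [IsMarkovKernel π] {f : X → ℝ} (hf : Measurable f) {C : ℝ}
    (hC : ∀ x, |f x| ≤ C) :
    HasSum (fun t => (1 - M.γ) * (M.γ ^ t * ∫ x, f x ∂M.stateLaw ρ π t))
      (∫ x, f x ∂M.occupancy ρ π) := by
  have h := hasSum_integral_measure
    (integrable_of_abs_le (μ := M.occupancy ρ π) hf hC)
  refine HasSum.congr_fun h fun t => ?_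
  have h1 : 0 ≤ 1 - M.γ := by linarith [M.γ_lt_one]
  rw [integral_smul_measure, ENNReal.toReal_ofReal
    (mul_nonneg h1 (pow_nonneg M.γ_pos.le t)), smul_eq_mul, mul_assoc]

/-- The performance difference lemma. -/
theorem integral_V_sub_J (M : MDP X A) (ρ : Measure X) [IsProbabilityMeasure ρ]
    (π σ : Kernel X A) [IsMarkovKernel π] [IsMarkovKernel σ] {C : ℝ}
    (hC : ∀ x a, |M.reward x a| ≤ C) :
    (∫ x, M.V σ x ∂ρ) - M.J ρ π =
      1 / (1 - M.γ) * ∫ x, (M.V σ x - ∫ a, M.Q σ x a ∂π x) ∂M.occupancy ρ π := by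
  have hVint : ∀ t, Integrable (M.V σ) (M.stateLaw ρ π t) := fun t => M.integrable_V σ hC _
  have hQmeas := M.measurable_integral_Q π σ hC
  have hQle : ∀ x, |∫ a, M.Q σ x a ∂π x| ≤ C / (1 - M.γ) := fun x =>
    abs_integral_le_of_abs_le (M.abs_Q_le σ hC x)
  have hocc := M.hasSum_integral_occupancy ρ π (f := fun x => M.V σ x - ∫ a, M.Q σ x a ∂π x)
    ((M.measurable_V σ hC).sub hQmeas) (C := C / (1 - M.γ) + C / (1 - M.γ)) fun x =>
      (abs_sub _ _).trans (add_le_add (M.abs_V_le σ hC x) (hQle x))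
  let v : ℕ → ℝ := fun t => ∫ x, M.V σ x ∂M.stateLaw ρ π t
  let r : ℕ → ℝ := fun t => ∫ z, M.meanReward π t z ∂(ρ ⊗ₘ π)
  -- The Bellman equation for `σ`, averaged over the state-action law of `π`; the next-state law
  -- turns the value term into `v (t + 1)`.
  have hterm : ∀ t, ∫ x, (M.V σ x - ∫ a, M.Q σ x a ∂π x) ∂M.stateLaw ρ π t =
      v t - r t - M.γ * v (t + 1) := by
    intro t
    have hr : Integrable (fun z : X × A => M.reward z.1 z.2) (M.stateLaw ρ π t ⊗ₘ π) :=
      integrable_of_abs_le M.measurable_uncurried_reward fun z => hC z.1 z.2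
    have hint : Integrable (M.V σ) (M.trans ∘ₘ (M.stateLaw ρ π t ⊗ₘ π)) := M.integrable_V σ hC _
    rw [integral_sub (hVint t) (integrable_of_abs_le hQmeas hQle),
      ← M.integral_Q_compProd π σ hC]
    simp only [fun z : X × A => M.Q_eq_reward_add σ hC z.1 z.2]
    rw [integral_add hr (Integrable.const_mul hint.integral_comp _), integral_const_mul,
      ← integral_measure_comp hint, ← stateLaw_succ,
      ← stepIter_comp_eq_stateLaw_compProd, M.integral_reward_stepIter_comp π hC]
    ring
  have hv : Summable fun t => M.γ ^ t * v t :=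
    M.summable_pow_mul_of_abs_le fun t => abs_integral_le_of_abs_le (M.abs_V_le σ hC)
  have h1 := hv.hasSum
  have h2 := (hasSum_nat_add_iff' 1).2 h1
  have h3 : HasSum (fun t => M.γ ^ t * r t) (M.J ρ π) :=
    M.hasSum_integral_discountedReturn π hC (ρ ⊗ₘ π)
  -- The shifted series `h2` cancels all of `h1` except `v 0`.
  have h4 := ((h1.sub h3).sub h2).mul_left (1 - M.γ)
  have h5 := h4.unique (HasSum.congr_fun hocc fun t => by rw [hterm]; ring)
  have hγ : 1 - M.γ ≠ 0 := by linarith [M.γ_lt_one]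
  have hv0 : v 0 = ∫ x, M.V σ x ∂ρ := by simp only [v, stateLaw_zero]
  rw [← h5, ← hv0]
  field_simp
  simp

end General

end MDP

/-! ### Optimal policies attain the optimal values. -/

namespace MDP

section Optimal

variable {X : Type u} {A : Type v} [MeasurableSpace X] [MeasurableSpace A]

lemma measurable_Q_right (M : MDP X A) (π : Kernel X A) [IsMarkovKernel π] {C : ℝ}
    (hC : ∀ x a, |M.reward x a| ≤ C) (x : X) : Measurable fun a => M.Q π x a := by
  have h := (M.measurable_Q π hC).comp (measurable_prodMk_left (x := x))
  exact h

/-- Optimality concerns `V`; monotonicity of the Bellman equation in `V` transfers it to `Q`. -/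
lemma IsOptimal.Q_le {M : MDP X A} {σ : Kernel X A} [IsMarkovKernel σ] (hσ : M.IsOptimal σ) {C : ℝ}
    (hC : ∀ x a, |M.reward x a| ≤ C) (π : Kernel X A) [IsMarkovKernel π] (x : X) (a : A) :
    M.Q π x a ≤ M.Q σ x a := by
  rw [M.Q_eq_reward_add π hC, M.Q_eq_reward_add σ hC]
  have := integral_mono (M.integrable_V π hC (M.trans (x, a)))
    (M.integrable_V σ hC (M.trans (x, a))) (hσ ⟨π, inferInstance⟩)
  have := mul_le_mul_of_nonneg_left this M.γ_pos.le
  linarith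

lemma IsOptimal.Qstar_eq {M : MDP X A} {σ : Kernel X A} [IsMarkovKernel σ] (hσ : M.IsOptimal σ)
    {C : ℝ} (hC : ∀ x a, |M.reward x a| ≤ C) (x : X) (a : A) : M.Qstar x a = M.Q σ x a := by
  have hle : ∀ π : Policy X A, (haveI := π.2; M.Q π.1 x a) ≤ M.Q σ x a := fun π =>
    have := π.2
    hσ.Q_le hC π.1 x a
  have : Nonempty (Policy X A) := ⟨⟨σ, inferInstance⟩⟩
  exact le_antisymm (ciSup_le hle) (le_ciSup_of_le
    ⟨M.Q σ x a, Set.forall_mem_range.2 hle⟩ ⟨σ, inferInstance⟩ le_rfl)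

lemma IsOptimal.Jstar_eq {M : MDP X A} {σ : Kernel X A} [IsMarkovKernel σ] (hσ : M.IsOptimal σ)
    {C : ℝ} (hC : ∀ x a, |M.reward x a| ≤ C) (ρ : Measure X) [IsProbabilityMeasure ρ] :
    M.Jstar ρ = ∫ x, M.V σ x ∂ρ := by
  have hle : ∀ π : Policy X A, (haveI := π.2; M.J ρ π.1) ≤ ∫ x, M.V σ x ∂ρ := fun π => by
    have := π.2
    rw [M.J_eq_integral_V π.1 hC]
    exact integral_mono (M.integrable_V π.1 hC ρ) (M.integrable_V σ hC ρ) (hσ π)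
  have : Nonempty (Policy X A) := ⟨⟨σ, inferInstance⟩⟩
  exact le_antisymm (ciSup_le hle) (le_ciSup_of_le
    ⟨_, Set.forall_mem_range.2 hle⟩ ⟨σ, inferInstance⟩ (M.J_eq_integral_V σ hC ρ).ge)

/-- Time 0 alone contributes mass `1 - γ` at the starting state. -/
lemma occupancy_dirac_singleton_ne_zero [MeasurableSingletonClass X] (M : MDP X A)
    (π : Kernel X A) [IsMarkovKernel π] (x : X) :
    M.occupancy (Measure.dirac x) π {x} ≠ 0 := by
  rw [occupancy, Measure.sum_apply _ (measurableSet_singleton x)]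
  refine (lt_of_lt_of_le ?_ (ENNReal.le_tsum 0)).ne'
  simp [stateLaw_zero, M.γ_lt_one]

/-- No action can beat an optimal policy: otherwise deviating to that action at the single state
`x` would improve the value at `x`. -/
lemma IsOptimal.Q_le_V [MeasurableSingletonClass X] {M : MDP X A} {σ : Kernel X A}
    [IsMarkovKernel σ] (hσ : M.IsOptimal σ) {C : ℝ} (hC : ∀ x a, |M.reward x a| ≤ C)
    (x : X) (a : A) : M.Q σ x a ≤ M.V σ x := by
  classical
  let dev : Kernel X A :=
    Kernel.piecewise (measurableSet_singleton x) (Kernel.const X (Measure.dirac a)) σ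
  have hpd := M.integral_V_sub_J (Measure.dirac x) dev σ hC
  -- Away from `x` the deviation agrees with `σ`, so the advantage gap vanishes there. The
  -- performance difference becomes a positive multiple of `V x - Q x a`.
  have hfun : ∀ y, M.V σ y - ∫ b, M.Q σ y b ∂dev y =
      ({x} : Set X).indicator (fun _ => M.V σ x - M.Q σ x a) y := by
    intro y
    by_cases hy : y = x
    · subst hy
      simp [dev, Kernel.piecewise_apply,
        integral_dirac' _ _ (M.measurable_Q_right σ hC y).stronglyMeasurable]
    · simp [dev, Kernel.piecewise_apply, hy, M.V_eq_integral_Q σ hC y]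
  simp only [hfun] at hpd
  rw [integral_indicator (measurableSet_singleton x), setIntegral_const, smul_eq_mul,
    integral_dirac' _ _ (M.measurable_V σ hC).stronglyMeasurable] at hpd
  have hopt : M.J (Measure.dirac x) dev ≤ M.V σ x := hσ ⟨dev, inferInstance⟩ x
  have hpos : 0 < (M.occupancy (Measure.dirac x) dev).real {x} :=
    ENNReal.toReal_pos (M.occupancy_dirac_singleton_ne_zero dev x) (measure_ne_top _ _)
  have hγ : 0 < 1 / (1 - M.γ) := one_div_pos.2 (by linarith [M.γ_lt_one])
  by_contra! hlt
  have := mul_neg_of_pos_of_neg hγ (mul_neg_of_pos_of_neg hpos (sub_neg.2 hlt))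
  linarith

/-- `Q_le_V` gives one inequality; conversely `V` is an average of `Q` over actions, hence at most
the supremum. -/
lemma IsOptimal.iSup_Qstar_eq [MeasurableSingletonClass X] {M : MDP X A} {σ : Kernel X A}
    [IsMarkovKernel σ] (hσ : M.IsOptimal σ) {C : ℝ} (hC : ∀ x a, |M.reward x a| ≤ C)
    (x : X) : ⨆ a, M.Qstar x a = M.V σ x := by
  have : Nonempty A := (σ x).nonempty_of_neZero
  simp only [hσ.Qstar_eq hC]
  have hbdd : BddAbove (Set.range fun a => M.Q σ x a) :=
    ⟨M.V σ x, Set.forall_mem_range.2 (hσ.Q_le_V hC x)⟩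
  refine le_antisymm (ciSup_le (hσ.Q_le_V hC x)) ?_
  rw [M.V_eq_integral_Q σ hC]
  calc ∫ a, M.Q σ x a ∂σ x ≤ ∫ _, (⨆ b, M.Q σ x b) ∂σ x :=
        integral_mono (integrable_of_abs_le (M.measurable_Q_right σ hC x) (M.abs_Q_le σ hC x)) (integrable_const _)
          fun a => le_ciSup hbdd a
    _ = ⨆ b, M.Q σ x b := by simp

end Optimal

end MDP

/-! ### Measurability in the task, and Bayes' rule. -/

namespace TaskDistribution

variable {Θ : Type w} {S : Type u} {A : Type v}
  [MeasurableSpace Θ] [MeasurableSpace S] [MeasurableSpace A]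

lemma measurable_step (𝒯 : TaskDistribution Θ S A) (κ : Kernel (Θ × PartialTraj S A) A)
    [IsMarkovKernel κ] :
    Measurable fun p : Θ × PartialTraj S A × A =>
      (𝒯.task p.1).augment.step (κ.sectR p.1) p.2 := by
  by_cases hne : Nonempty (Θ × PartialTraj S A × A)
  swap
  · have := not_nonempty_iff.1 hne
    exact measurable_of_empty _
  obtain ⟨θ₀, -, -⟩ := hne
  -- The policy at `θ₀` is a dummy: dropping the action from `jointStep` leaves the transition, now
  -- a kernel in the task too. The task-dependent policy is then attached by `η`.
  let T : Kernel (Θ × PartialTraj S A × A) (PartialTraj S A) :=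
    (𝒯.jointStep (κ.sectR θ₀)).map Prod.fst
  have hT : ∀ p, T p = (𝒯.task p.1).augment.trans p.2 := fun p => by
    rw [Kernel.map_apply _ measurable_fst, jointStep_apply, MDP.step_apply]
    exact Measure.fst_compProd _ _
  have hTM : IsMarkovKernel T := ⟨fun p => by rw [hT]; infer_instance⟩
  let η : Kernel ((Θ × PartialTraj S A × A) × PartialTraj S A) A :=
    κ.comap (fun q => (q.1.1, q.2)) (by fun_prop)
  convert (T ⊗ₖ η).measurable using 2 with p
  rw [Kernel.compProd_apply_eq_compProd_sectR, hT, MDP.step_apply]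
  rfl

lemma measurable_Q (𝒯 : TaskDistribution Θ S A) (κ : Kernel (Θ × PartialTraj S A) A)
    [IsMarkovKernel κ] {B : Θ → ℝ} (hR : ∀ θ s a, |𝒯.reward θ s a| ≤ B θ) :
    Measurable fun p : Θ × PartialTraj S A × A =>
      (𝒯.task p.1).augment.Q (κ.sectR p.1) p.2.1 p.2.2 := by
  refine MDP.measurable_Q_family (fun θ => (𝒯.task θ).augment) (fun θ => κ.sectR θ)
    (𝒯.measurable_step κ) ?_ measurable_const (C := B) fun θ l a => hR θ l.last a
  have := PartialTraj.measurable_last (S := S) (A := A)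
  exact 𝒯.measurable_reward.comp (by fun_prop :
    Measurable fun p : Θ × PartialTraj S A × A => (p.1, p.2.1.last, p.2.2))

lemma measurable_V (𝒯 : TaskDistribution Θ S A) (κ : Kernel (Θ × PartialTraj S A) A)
    [IsMarkovKernel κ] {B : Θ → ℝ} (hR : ∀ θ s a, |𝒯.reward θ s a| ≤ B θ) :
    Measurable fun p : Θ × PartialTraj S A => (𝒯.task p.1).augment.V (κ.sectR p.1) p.2 := by
  simp only [fun θ => (𝒯.task θ).augment.V_eq_integral_Q (κ.sectR θ)
    (fun l a => hR θ l.last a)]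
  have h := (𝒯.measurable_Q κ hR).comp (by fun_prop :
      Measurable fun q : (Θ × PartialTraj S A) × A => (q.1.1, q.1.2, q.2))
  exact (h.stronglyMeasurable.integral_kernel_prod_right' (κ := κ)).measurable

lemma measurable_integral_V (𝒯 : TaskDistribution Θ S A) (κ : Kernel (Θ × PartialTraj S A) A)
    [IsMarkovKernel κ] {B : Θ → ℝ} (hR : ∀ θ s a, |𝒯.reward θ s a| ≤ B θ) :
    Measurable fun θ => ∫ l, (𝒯.task θ).augment.V (κ.sectR θ) l ∂𝒯.augInit :=
  ((𝒯.measurable_V κ hR).stronglyMeasurable.integral_prod_right' (ν := 𝒯.augInit)).measurable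

lemma J_eq_integral_V (𝒯 : TaskDistribution Θ S A) (π : Kernel (PartialTraj S A) A)
    [IsMarkovKernel π] {B : Θ → ℝ} (hR : ∀ θ s a, |𝒯.reward θ s a| ≤ B θ) (θ : Θ) :
    𝒯.J π θ = ∫ l, (𝒯.task θ).augment.V π l ∂𝒯.augInit :=
  (𝒯.task θ).augment.J_eq_integral_V π (fun l a => hR θ l.last a) _

lemma measurable_J (𝒯 : TaskDistribution Θ S A) (π : Kernel (PartialTraj S A) A)
    [IsMarkovKernel π] {B : Θ → ℝ} (hR : ∀ θ s a, |𝒯.reward θ s a| ≤ B θ) :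
    Measurable (𝒯.J π) := by
  -- `π` is viewed as a family of policies constant in the task.
  have h := 𝒯.measurable_integral_V (π.prodMkLeft Θ) hR
  rw [funext (𝒯.J_eq_integral_V π hR)]
  simpa only [Kernel.sectR_prodMkLeft] using h

/-- Transfers integrability of the reward bound from the prior to almost every posterior. -/
lemma taskPosterior_comp_trajDist [StandardBorelSpace Θ] [Nonempty Θ]
    (𝒯 : TaskDistribution Θ S A) (π : Kernel (PartialTraj S A) A) [IsMarkovKernel π] :
    𝒯.taskPosterior π ∘ₘ 𝒯.trajDist π = 𝒯.prior :=
  posterior_comp_self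

instance [StandardBorelSpace Θ] [Nonempty Θ] (𝒯 : TaskDistribution Θ S A)
    (π : Kernel (PartialTraj S A) A) [IsMarkovKernel π] : IsMarkovKernel (𝒯.taskPosterior π) := by
  unfold taskPosterior; infer_instance

instance (𝒯 : TaskDistribution Θ S A)
    (π : Kernel (PartialTraj S A) A) [IsMarkovKernel π] : IsProbabilityMeasure (𝒯.trajDist π) := by
  unfold trajDist; infer_instance

/-- The Bayes rule: averaging over the posterior is averaging over the occupancies of all tasks. -/
lemma integral_trajDist_taskPosterior [StandardBorelSpace Θ] [Nonempty Θ]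
    (𝒯 : TaskDistribution Θ S A) (π : Kernel (PartialTraj S A) A) [IsMarkovKernel π]
    {f : PartialTraj S A × Θ → ℝ} (hf : Integrable f (𝒯.trajDist π ⊗ₘ 𝒯.taskPosterior π)) :
    ∫ l, ∫ θ, f (l, θ) ∂𝒯.taskPosterior π l ∂𝒯.trajDist π =
      ∫ θ, ∫ l, f (l, θ) ∂𝒯.occupancy π θ ∂𝒯.prior := by
  have hswap : 𝒯.trajDist π ⊗ₘ 𝒯.taskPosterior π =
      (𝒯.prior ⊗ₘ 𝒯.occupancy π).map Prod.swap := compProd_posterior_eq_map_swap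
  rw [← Measure.integral_compProd hf]
  rw [hswap] at hf ⊢
  rw [integral_map measurable_swap.aemeasurable hf.aestronglyMeasurable]
  exact Measure.integral_compProd (hf.comp_measurable measurable_swap)

end TaskDistribution

/-! ### Suprema and posterior means under a bound depending only on the task. -/

/-- The supremum over a standard Borel parameter of a jointly measurable real function is
almost everywhere measurable if almost all of its sections are bounded. -/
lemma aemeasurable_iSup_real_of_standardBorel {X Y : Type*} [MeasurableSpace X]
    [StandardBorelSpace X] [MeasurableSpace Y] [StandardBorelSpace Y] [Nonempty Y]
    {g : X × Y → ℝ} (hg : Measurable g) (μ : Measure X) [IsFiniteMeasure μ]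
    (hbdd : ∀ᵐ x ∂μ, BddAbove (Set.range fun y => g (x, y))) :
    AEMeasurable (fun x => ⨆ y, g (x, y)) μ := by
  have h := aemeasurable_iSup_of_standardBorel (g := fun p => (g p : EReal))
    (measurable_coe_real_ereal.comp hg) μ
  refine h.ereal_toReal.congr ?_
  filter_upwards [hbdd] with x hx
  -- Boundedness matters: an unbounded real supremum takes the default value 0.
  have heq : (⨆ y, (g (x, y) : EReal)) = ((⨆ y, g (x, y) : ℝ) : EReal) := by
    refine le_antisymm (iSup_le fun y => EReal.coe_le_coe_iff.2 (le_ciSup hx y)) ?_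
    refine EReal.le_of_forall_lt_iff_le.1 fun z hz => ?_
    refine EReal.coe_le_coe_iff.2 (ciSup_le fun y => ?_)
    exact EReal.coe_le_coe_iff.1 ((le_iSup (fun y => (g (x, y) : EReal)) y).trans hz.le)
  rw [heq, EReal.toReal_coe]

lemma MeasureTheory.Integrable.integral_measure_compProd {X Y : Type*} [MeasurableSpace X]
    [MeasurableSpace Y] {μ : Measure X} [SFinite μ] {κ : Kernel X Y} [IsSFiniteKernel κ]
    {f : X × Y → ℝ} (hf : Integrable f (μ ⊗ₘ κ)) :
    Integrable (fun x => ∫ y, f (x, y) ∂κ x) μ := by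
  simpa using! MeasureTheory.Integrable.integral_compProd hf

section PosteriorMean

variable {L Θ A : Type*} [MeasurableSpace L] [MeasurableSpace Θ] [MeasurableSpace A]
  {κ : Kernel L Θ} {π : Kernel L A}
  {b : Θ → ℝ} {q : Θ → L → A → ℝ} {v : Θ → L → ℝ}

lemma integrable_section (hqm : Measurable fun p : Θ × L × A => q p.1 p.2.1 p.2.2)
    (hq : ∀ θ l a, |q θ l a| ≤ b θ) {l : L} (hl : Integrable b (κ l)) (a : A) :
    Integrable (fun θ => q θ l a) (κ l) :=
  hl.mono' (hqm.comp (by fun_prop : Measurable fun θ : Θ => (θ, l, a))).aestronglyMeasurable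
    (Filter.Eventually.of_forall fun θ => hq θ l a)

lemma abs_integral_section_le (hq : ∀ θ l a, |q θ l a| ≤ b θ) {l : L}
    (hl : Integrable b (κ l)) (a : A) : |∫ θ, q θ l a ∂κ l| ≤ ∫ θ, b θ ∂κ l :=
  norm_integral_le_of_norm_le (f := fun θ => q θ l a) hl
    (Filter.Eventually.of_forall fun θ => hq θ l a)

lemma bddAbove_integral_section (hq : ∀ θ l a, |q θ l a| ≤ b θ) {l : L}
    (hl : Integrable b (κ l)) : BddAbove (Set.range fun a => ∫ θ, q θ l a ∂κ l) :=
  ⟨_, Set.forall_mem_range.2 fun a => (le_abs_self _).trans (abs_integral_section_le hq hl a)⟩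

variable [IsMarkovKernel κ] [IsMarkovKernel π]

lemma integrable_prod_section (hqm : Measurable fun p : Θ × L × A => q p.1 p.2.1 p.2.2)
    (hq : ∀ θ l a, |q θ l a| ≤ b θ) {l : L} (hl : Integrable b (κ l)) :
    Integrable (fun x : A × Θ => q x.2 l x.1) ((π l).prod (κ l)) :=
  (hl.comp_snd (π l)).mono'
    (hqm.comp (by fun_prop : Measurable fun x : A × Θ => (x.2, l, x.1))).aestronglyMeasurable
    (Filter.Eventually.of_forall fun x => hq x.2 l x.1)

/-- Source of the lower bound: by Fubini, the left side averages the posterior means over actions.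
-/
lemma integral_prod_section_le_iSup (hqm : Measurable fun p : Θ × L × A => q p.1 p.2.1 p.2.2)
    (hq : ∀ θ l a, |q θ l a| ≤ b θ) {l : L} (hl : Integrable b (κ l)) :
    ∫ x : A × Θ, q x.2 l x.1 ∂((π l).prod (κ l)) ≤ ⨆ a, ∫ θ, q θ l a ∂κ l := by
  have hint := integrable_prod_section (π := π) hqm hq hl
  rw [integral_prod _ hint]
  calc ∫ a, ∫ θ, q θ l a ∂κ l ∂π l
      ≤ ∫ _, (⨆ b, ∫ θ, q θ l b ∂κ l) ∂π l :=
        integral_mono hint.integral_prod_left (integrable_const _)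
          fun a => le_ciSup (bddAbove_integral_section hq hl) a
    _ = _ := by simp

variable {μ : Measure L}

/-- The posterior mean of the advantage gap, split into its two terms. -/
lemma integral_sub_eq_ae (hb : Integrable b (κ ∘ₘ μ))
    (hqm : Measurable fun p : Θ × L × A => q p.1 p.2.1 p.2.2)
    (hq : ∀ θ l a, |q θ l a| ≤ b θ) (hvm : Measurable fun p : L × Θ => v p.2 p.1)
    (hv : ∀ θ l, |v θ l| ≤ b θ) :
    (fun l => ∫ θ, (v θ l - ∫ a, q θ l a ∂π l) ∂κ l) =ᵐ[μ]
      fun l => (∫ θ, v θ l ∂κ l) - ∫ x : A × Θ, q x.2 l x.1 ∂((π l).prod (κ l)) := by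
  filter_upwards [Measure.ae_integrable_of_integrable_comp hb] with l hl
  have hint := integrable_prod_section (π := π) hqm hq hl
  have hvl : Integrable (fun θ => v θ l) (κ l) :=
    hl.mono' (hvm.comp (by fun_prop : Measurable fun θ : Θ => (l, θ))).aestronglyMeasurable
      (Filter.Eventually.of_forall fun θ => hv θ l)
  rw [integral_prod_symm _ hint, integral_sub hvl hint.integral_prod_right]

variable [IsProbabilityMeasure μ]

/-- The dominating `b` sees only the second coordinate, whose marginal law is `κ ∘ₘ μ`. -/
lemma integrable_compProd_of_abs_le (hb : Integrable b (κ ∘ₘ μ))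
    (hvm : Measurable fun p : L × Θ => v p.2 p.1) (hv : ∀ θ l, |v θ l| ≤ b θ) :
    Integrable (fun p : L × Θ => v p.2 p.1) (μ ⊗ₘ κ) :=
  ((Measure.integrable_compProd_snd_iff hb.1).2 hb).mono' hvm.aestronglyMeasurable
    (Filter.Eventually.of_forall fun p => hv p.2 p.1)

lemma integrable_compProd_integral (hb : Integrable b (κ ∘ₘ μ))
    (hqm : Measurable fun p : Θ × L × A => q p.1 p.2.1 p.2.2)
    (hq : ∀ θ l a, |q θ l a| ≤ b θ) :
    Integrable (fun p : L × Θ => ∫ a, q p.2 p.1 a ∂π p.1) (μ ⊗ₘ κ) := by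
  refine integrable_compProd_of_abs_le (v := fun θ l => ∫ a, q θ l a ∂π l) hb ?_
    fun θ l => abs_integral_le_of_abs_le (hq θ l)
  exact ((hqm.comp (by fun_prop : Measurable fun x : (L × Θ) × A =>
      (x.1.2, x.1.1, x.2))).stronglyMeasurable.integral_kernel_prod_right'
        (κ := π.prodMkRight Θ)).measurable

lemma integrable_iSup_integral [StandardBorelSpace L] [StandardBorelSpace A] [Nonempty A]
    (hb : Integrable b (κ ∘ₘ μ)) (hqm : Measurable fun p : Θ × L × A => q p.1 p.2.1 p.2.2)
    (hq : ∀ θ l a, |q θ l a| ≤ b θ) : Integrable (fun l => ⨆ a, ∫ θ, q θ l a ∂κ l) μ := by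
  have hbl := Measure.ae_integrable_of_integrable_comp hb
  have hmean : Integrable (fun l => ∫ θ, b θ ∂κ l) μ :=
    ((Measure.integrable_compProd_snd_iff hb.1).2 hb).integral_measure_compProd
  refine hmean.mono' (AEMeasurable.aestronglyMeasurable ?_) ?_
  · refine aemeasurable_iSup_real_of_standardBorel
      (g := fun p : L × A => ∫ θ, q θ p.1 p.2 ∂κ p.1) ?_ _ ?_
    · exact ((hqm.comp (by fun_prop : Measurable fun x : (L × A) × Θ =>
        (x.2, x.1.1, x.1.2))).stronglyMeasurable.integral_kernel_prod_right'
          (κ := κ.prodMkRight A)).measurable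
    · filter_upwards [hbl] with l hl using bddAbove_integral_section hq hl
  · filter_upwards [hbl] with l hl
    -- Any single action bounds the supremum from below.
    obtain ⟨a₀⟩ := ‹Nonempty A›
    refine abs_le.2 ⟨?_, ciSup_le fun a => (abs_le.1 (abs_integral_section_le hq hl a)).2⟩
    exact (abs_le.1 (abs_integral_section_le hq hl a₀)).1.trans
      (le_ciSup (bddAbove_integral_section hq hl) a₀)

end PosteriorMean

end

/-! ### The main theorem. -/

theorem theorem4 {Θ S A : Type*}
    [MeasurableSpace Θ] [StandardBorelSpace Θ] [Nonempty Θ]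
    [MeasurableSpace S] [StandardBorelSpace S]
    [MeasurableSpace A] [StandardBorelSpace A]
    (𝒯 : TaskDistribution Θ S A)
    -- rewards are bounded in each task, with bounds integrable over the task distribution
    (B : Θ → ℝ) (hB : Integrable B 𝒯.prior)
    (hR : ∀ θ s a, |𝒯.reward θ s a| ≤ B θ)
    -- every task has an optimal policy, chosen measurably in the task
    (πstar : Kernel (Θ × PartialTraj S A) A) [IsMarkovKernel πstar]
    (hπstar : ∀ θ, (𝒯.task θ).augment.IsOptimal (πstar.sectR θ))
    (π : Kernel (PartialTraj S A) A) [IsMarkovKernel π] :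
    -- all the expectations below are well defined
    (Integrable 𝒯.Jstar 𝒯.prior ∧ Integrable (𝒯.J π) 𝒯.prior ∧
      (∀ᵐ l ∂𝒯.trajDist π,
        Integrable (fun θ => ⨆ a, 𝒯.Qstar θ l a) (𝒯.taskPosterior π l) ∧
        Integrable (fun x : A × Θ => 𝒯.Qstar x.2 l x.1) ((π l).prod (𝒯.taskPosterior π l)) ∧
        (∀ a, Integrable (fun θ => 𝒯.Qstar θ l a) (𝒯.taskPosterior π l)) ∧
        BddAbove (Set.range fun a => ∫ θ, 𝒯.Qstar θ l a ∂𝒯.taskPosterior π l)) ∧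
      Integrable (fun l =>
        (∫ θ, ⨆ a, 𝒯.Qstar θ l a ∂𝒯.taskPosterior π l) -
          ∫ x : A × Θ, 𝒯.Qstar x.2 l x.1 ∂((π l).prod (𝒯.taskPosterior π l)))
        (𝒯.trajDist π) ∧
      Integrable (fun l =>
        (∫ θ, ⨆ a, 𝒯.Qstar θ l a ∂𝒯.taskPosterior π l) -
          ⨆ a, ∫ θ, 𝒯.Qstar θ l a ∂𝒯.taskPosterior π l)
        (𝒯.trajDist π)) ∧
    -- the exact formula for the optimality gap
    (∫ θ, 𝒯.Jstar θ ∂𝒯.prior) - ∫ θ, 𝒯.J π θ ∂𝒯.prior =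
      1 / (1 - 𝒯.γ) * ∫ l,
        ((∫ θ, ⨆ a, 𝒯.Qstar θ l a ∂𝒯.taskPosterior π l) -
          ∫ x : A × Θ, 𝒯.Qstar x.2 l x.1 ∂((π l).prod (𝒯.taskPosterior π l)))
        ∂𝒯.trajDist π ∧
    -- the lower bound
    (∫ θ, 𝒯.Jstar θ ∂𝒯.prior) - ∫ θ, 𝒯.J π θ ∂𝒯.prior ≥
      1 / (1 - 𝒯.γ) * ∫ l,
        ((∫ θ, ⨆ a, 𝒯.Qstar θ l a ∂𝒯.taskPosterior π l) -
          ⨆ a, ∫ θ, 𝒯.Qstar θ l a ∂𝒯.taskPosterior π l)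
        ∂𝒯.trajDist π := by
  have hC : ∀ θ (l : PartialTraj S A) a, |(𝒯.task θ).augment.reward l a| ≤ B θ :=
    fun θ l a => hR θ l.last a
  have hγ : 0 < 1 - 𝒯.γ := by linarith [𝒯.γ_lt_one]
  -- The initial law and the policy are probability measures, so states and actions exist; the
  -- supremum over actions needs this.
  obtain ⟨s₀⟩ : Nonempty S := 𝒯.init.nonempty_of_neZero
  have : Nonempty A := (π (PartialTraj.start s₀)).nonempty_of_neZero
  have hQ : ∀ θ l a, 𝒯.Qstar θ l a = (𝒯.task θ).augment.Q (πstar.sectR θ) l a :=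
    fun θ => (hπstar θ).Qstar_eq (hC θ)
  -- Deviating at one partial trajectory requires singletons to be measurable, which holds as
  -- `PartialTraj S A` is standard Borel.
  have hV : ∀ θ l, ⨆ a, 𝒯.Qstar θ l a = (𝒯.task θ).augment.V (πstar.sectR θ) l :=
    fun θ => (hπstar θ).iSup_Qstar_eq (hC θ)
  have hJstar : ∀ θ, 𝒯.Jstar θ = ∫ l, (𝒯.task θ).augment.V (πstar.sectR θ) l ∂𝒯.augInit :=
    fun θ => (hπstar θ).Jstar_eq (hC θ) _
  have hJstar_int : Integrable 𝒯.Jstar 𝒯.prior := by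
    refine (hB.div_const (1 - 𝒯.γ)).mono' ?_ (Filter.Eventually.of_forall fun θ => ?_)
    · rw [funext hJstar]
      exact (𝒯.measurable_integral_V πstar hR).aestronglyMeasurable
    · rw [hJstar]
      exact abs_integral_le_of_abs_le ((𝒯.task θ).augment.abs_V_le _ (hC θ))
  have hJ_int : Integrable (𝒯.J π) 𝒯.prior := by
    refine (hB.div_const (1 - 𝒯.γ)).mono' (𝒯.measurable_J π hR).aestronglyMeasurable
      (Filter.Eventually.of_forall fun θ => ?_)
    rw [𝒯.J_eq_integral_V π hR]
    exact abs_integral_le_of_abs_le ((𝒯.task θ).augment.abs_V_le _ (hC θ))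
  have hgap : ∀ θ, 𝒯.Jstar θ - 𝒯.J π θ = 1 / (1 - 𝒯.γ) *
      ∫ l, ((⨆ a, 𝒯.Qstar θ l a) - ∫ a, 𝒯.Qstar θ l a ∂π l) ∂𝒯.occupancy π θ := by
    intro θ
    have h := (𝒯.task θ).augment.integral_V_sub_J 𝒯.augInit π (πstar.sectR θ) (hC θ)
    rw [← hJstar] at h
    simp only [← hV, ← hQ] at h
    exact h
  have hqm : Measurable fun p : Θ × PartialTraj S A × A => 𝒯.Qstar p.1 p.2.1 p.2.2 := by
    simp only [hQ]
    exact 𝒯.measurable_Q πstar hR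
  have hvm : Measurable fun p : PartialTraj S A × Θ => ⨆ a, 𝒯.Qstar p.2 p.1 a := by
    simp only [hV]
    have h := (𝒯.measurable_V πstar hR).comp measurable_swap
    exact h
  have hq : ∀ θ l a, |𝒯.Qstar θ l a| ≤ B θ / (1 - 𝒯.γ) := fun θ l a => by
    rw [hQ]
    exact (𝒯.task θ).augment.abs_Q_le _ (hC θ) l a
  have hv : ∀ θ l, |⨆ a, 𝒯.Qstar θ l a| ≤ B θ / (1 - 𝒯.γ) := fun θ l => by
    rw [hV]
    exact (𝒯.task θ).augment.abs_V_le _ (hC θ) l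
  -- From here on only measurability, the bounds and `hgap` are needed, so `Qstar` becomes an
  -- arbitrary `q`.
  clear hQ hV hJstar
  generalize 𝒯.Qstar = q at *
  have hb : Integrable (fun θ => B θ / (1 - 𝒯.γ)) (𝒯.taskPosterior π ∘ₘ 𝒯.trajDist π) := by
    rw [𝒯.taskPosterior_comp_trajDist π]
    exact hB.div_const _
  have hbl := Measure.ae_integrable_of_integrable_comp hb
  have hv_int := integrable_compProd_of_abs_le (v := fun θ l => ⨆ a, q θ l a) hb hvm hv
  have hadv_int := hv_int.sub (integrable_compProd_integral (π := π) hb hqm hq)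
  have hadv := integral_sub_eq_ae (π := π) (v := fun θ l => ⨆ a, q θ l a) hb hqm hq hvm hv
  have hgap_int := hadv_int.integral_measure_compProd.congr hadv
  have hbound_int := hv_int.integral_measure_compProd.sub (integrable_iSup_integral hb hqm hq)
  have hformula : (∫ θ, 𝒯.Jstar θ ∂𝒯.prior) - ∫ θ, 𝒯.J π θ ∂𝒯.prior =
      1 / (1 - 𝒯.γ) * ∫ l,
        ((∫ θ, ⨆ a, q θ l a ∂𝒯.taskPosterior π l) -
          ∫ x : A × Θ, q x.2 l x.1 ∂((π l).prod (𝒯.taskPosterior π l)))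
        ∂𝒯.trajDist π := by
    -- The per-task gap is integrated over the prior, and Bayes' rule exchanges the order of task
    -- and trajectory.
    rw [← integral_sub hJstar_int hJ_int, ← integral_congr_ae hadv, integral_congr_ae
      (Filter.Eventually.of_forall hgap), integral_const_mul]
    exact congrArg _ (𝒯.integral_trajDist_taskPosterior π hadv_int).symm
  refine ⟨⟨hJstar_int, hJ_int, ?_, hgap_int, hbound_int⟩, hformula, ?_⟩
  · filter_upwards [hbl] with l hl
    exact ⟨hl.mono' (hvm.comp (by fun_prop : Measurable fun θ : Θ => (l, θ))).aestronglyMeasurable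
      (Filter.Eventually.of_forall fun θ => hv θ l),
      integrable_prod_section hqm hq hl, integrable_section hqm hq hl,
      bddAbove_integral_section hq hl⟩
  · rw [hformula, ge_iff_le]
    refine mul_le_mul_of_nonneg_left (integral_mono_ae hbound_int hgap_int ?_)
      (one_div_pos.2 hγ).le
    filter_upwards [hbl] with l hl
    exact sub_le_sub_left (integral_prod_section_le_iSup hqm hq hl) _
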